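/- Let $N\ge 1$ and $0\le \ell\le N$ be integers and let $q\in\mathbb{C}$ with $0<|q|<1$. Write $(a)_n=\prod_{k=0}^{n-1}(1-aq^k)$, $(a)_\infty=\prod_{k\ge 0}(1-aq^k)$, and $\left[{A\atop B}\right]=\frac{(q)_A}{(q)_B(q)_{A-B}}$ if $0\le B\le A$, $\left[{A\atop B}\right]=0$ otherwise. Fractional powers are $q^{r}=e^{r\log q}$ with the principal value of $\log q$. Let $\mathcal I$ be the $(N-1)\times(N-1)$ matrix with entries $\mathcal I_{j,k}=\delta_{j,k-1}+\delta_{j,k+1}$, let $C=2I-\mathcal I$ be the Cartan matrix of $\mathrm A_{N-1}$, and for $p\in\mathbb{Z}$ let $\vec{\mathrm e}_p$ be the $(N-1)$-dimensional vector with entries $(\vec{\mathrm e}_p)_j=\delta_{p,j}$, $1\le j\le N-1$ (so $\vec{\mathrm e}_0=\vec{\mathrm e}_N=0$); for $N=1$ all vectors are empty and $(C^{-1}\vec k)_1$ is read as $0$. Let $(\alpha,\beta)$ be a Bailey pair relative to $q^\ell$, i.e. $\alpha=(\alpha_L)_{L\ge0}$ and $\beta=(\beta_L)_{L\ge0}$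 are complex sequences with $$\beta_L=\sum_{k=0}^{L}\frac{\alpha_k}{(q)_{L-k}\,(q^{\ell+1})_{L+k}}\qquad(L\ge 0),$$ and suppose that $\sum_{L\ge0} q^{L(L+\ell)/N}\alpha_L$ converges absolutely. Then $$\frac{1}{(q^{\ell+1})_\infty}\sum_{L=0}^{\infty}q^{L(L+\ell)/N}\,\alpha_L\sum_{\frac LN-(C^{-1}\vec\eta)_1\in\mathbb Z}\frac{q^{\vec\eta\,C^{-1}(\vec\eta-\vec{\mathrm e}_\ell)}}{(q)_{\eta_1}\cdots(q)_{\eta_{N-1}}} =\sum_{L=0}^{\infty}q^{L(L+\ell)/N}\,\beta_L\sum_{\frac LN-(C^{-1}\vec n)_1\in\mathbb Z}q^{\vec n\,C^{-1}(\vec n-\vec{\mathrm e}_\ell)}\prod_{j=1}^{N-1}\left[{m_j+n_j\atop n_j}\right].$$ Here the inner sums run over the vectors $\vec\eta$, respectively $\vec n$, in $\mathbb{Z}_{\ge0}^{N-1}$ that satisfy the displayed condition; on the right $\vec m$ is determined by $\vec n$ through $$\vec m+\vec n=\tfrac12\left(\mathcal I\,\vec m+(2L+\ell)\,\vec{\mathrm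 e}_{N-1}+\vec{\mathrm e}_\ell\right),$$ and only those $\vec n$ contribute for which $\vec m$ has non-negative integer entries. Both outer series and the $\vec\eta$-sums converge absolutely, and for each $L$ only finitely many $\vec n$ contribute. -/

import Mathlib

open scoped Matrix

namespace HigherBailey

/-- The finite `q`-shifted factorial `(a;q)_n = (1 - a)(1 - a q) ⋯ (1 - a q^(n-1))`. -/
noncomputable def qPoch (q a : ℂ) (n : ℕ) : ℂ :=
  ∏ k ∈ Finset.range n, (1 - a * q ^ k)

/-- The infinite `q`-shifted factorial `(a;q)_∞ = ∏_{k ≥ 0} (1 - a q^k)`, for `|q| < 1`. -/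
noncomputable def qPochInf (q a : ℂ) : ℂ :=
  ∏' k : ℕ, (1 - a * q ^ k)

/-- The Gaussian polynomial, with the value `0` unless `0 ≤ B ≤ A`. -/
noncomputable def gauss (q : ℂ) (A B : ℕ) : ℂ :=
  if B ≤ A then qPoch q q A / (qPoch q q B * qPoch q q (A - B)) else 0

/-- `(α, β)` is a Bailey pair relative to `a` (with base `q`). -/
def IsBaileyPair (q a : ℂ) (α β : ℕ → ℂ) : Prop :=
  ∀ L : ℕ, β L = ∑ k ∈ Finset.range (L + 1),
    α k / (qPoch q q (L - k) * qPoch q (a * q) (L + k))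

/-- The rational power `q^r` (principal branch). -/
noncomputable def qpow (q : ℂ) (r : ℚ) : ℂ := q ^ (r : ℂ)

/-- The incidence matrix of `A_{N-1}`; the entry `i : Fin (N - 1)` is the node `i + 1`. -/
def incidence (N : ℕ) : Matrix (Fin (N - 1)) (Fin (N - 1)) ℚ :=
  Matrix.of fun i j =>
    (if i.val + 1 = j.val then 1 else 0) + (if i.val = j.val + 1 then 1 else 0)

/-- The Cartan matrix `C = 2 I - 𝓘` of `A_{N-1}`. -/
def cartan (N : ℕ) : Matrix (Fin (N - 1)) (Fin (N - 1)) ℚ :=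
  (2 : ℚ) • (1 : Matrix (Fin (N - 1)) (Fin (N - 1)) ℚ) - incidence N

/-- The vector `e_p` with entries `δ_{p,j}`, `1 ≤ j ≤ N - 1`; it is zero for `p = 0` and `p = N`. -/
def unitVec (N p : ℕ) : Fin (N - 1) → ℚ :=
  fun i => if i.val + 1 = p then 1 else 0

/-- A vector of non-negative integers as a rational vector. -/
def toRat {d : ℕ} (k : Fin d → ℕ) : Fin d → ℚ := fun i => (k i : ℚ)

/-- The condition `L / N - (C⁻¹ k)_1 ∈ ℤ`. -/
def Congr (N L : ℕ) (k : Fin (N - 1) → ℕ) : Prop :=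
  ∃ z : ℤ, (L : ℚ) / N - unitVec N 1 ⬝ᵥ ((cartan N)⁻¹ *ᵥ toRat k) = z

/-- The exponent `k C⁻¹ (k - e_ℓ)`. -/
noncomputable def quadExp (N ℓ : ℕ) (k : Fin (N - 1) → ℕ) : ℚ :=
  toRat k ⬝ᵥ ((cartan N)⁻¹ *ᵥ (toRat k - unitVec N ℓ))

/-- The exponent `L (L + ℓ) / N`. -/
def outerExp (N ℓ L : ℕ) : ℚ := (L : ℚ) * ((L : ℚ) + ℓ) / N

/-- The `(m, n)`-system `m + n = (𝓘 m + (2 L + ℓ) e_{N-1} + e_ℓ) / 2`. -/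
def MNSystem (N ℓ L : ℕ) (m n : Fin (N - 1) → ℕ) : Prop :=
  toRat m + toRat n = (1 / 2 : ℚ) •
    (incidence N *ᵥ toRat m + (2 * (L : ℚ) + ℓ) • unitVec N (N - 1) + unitVec N ℓ)

/-- The pairs `(m, n)` of vectors of non-negative integers over which the fermionic sum runs.
The vector `m` is determined by `n`. -/
def mnPairs (N ℓ L : ℕ) : Set ((Fin (N - 1) → ℕ) × (Fin (N - 1) → ℕ)) :=
  {p | Congr N L p.2 ∧ MNSystem N ℓ L p.1 p.2}

/-- The fermionic polynomial
`∑_n q^(n C⁻¹ (n - e_ℓ)) ∏_j [m_j + n_j, n_j]`. -/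
noncomputable def fermionicPoly (q : ℂ) (N ℓ L : ℕ) : ℂ :=
  ∑ᶠ p ∈ mnPairs N ℓ L,
    qpow q (quadExp N ℓ p.2) * ∏ j, gauss q (p.1 j + p.2 j) (p.2 j)

/-- The term `q^(η C⁻¹ (η - e_ℓ)) / ((q)_{η_1} ⋯ (q)_{η_{N-1}})`. -/
noncomputable def etaTerm (q : ℂ) (N ℓ : ℕ) (η : Fin (N - 1) → ℕ) : ℂ :=
  qpow q (quadExp N ℓ η) / ∏ j, qPoch q q (η j)

/-- The sum of these terms over all `η` with `L / N - (C⁻¹ η)_1 ∈ ℤ`. -/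
noncomputable def etaSum (q : ℂ) (N ℓ L : ℕ) : ℂ :=
  ∑' η : {η : Fin (N - 1) → ℕ // Congr N L η}, etaTerm q N ℓ η.1

end HigherBailey

namespace HigherBailey

open Finset Filter Topology

/-! ### q-shifted factorials and Gaussian polynomials -/

section Pochhammer

variable {q : ℂ}

/-! Everything reduces to a conjugate Bailey pair (`tsum_conjugate`), obtained as the limit of a
finite identity with an extra parameter `n`.

Put `K_j = jL/N - (C⁻¹η)_j`. The congruence condition says that `0 = K_0, …, K_N = L` is an integer
path, and `η_j` is its second difference, so vectors `η` correspond to convex integer paths. The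
total exponent becomes `∑ (K_{i+1} - K_i)² + K_ℓ`, an integer, and the `(m, n)`-system says `m_j = 2
K_j + min(j, ℓ)`. Both inner sums are therefore sums over the same paths.

Add `n` to both entries of each Gaussian polynomial and let `S(n, k)` (`closedSum`) be the resulting
sum over paths ending at `k`. At `n = 0` it gives the fermionic polynomial, and as `n → ∞` it gives
the `η`-sum. By the `q`-Pascal rule, `S(n+1, k) + (1 - q^n) S(n-1, k+1) = (1 - q^{n+1+2k+ℓ}) S(n, k)
+ S(n, k+1)` (`pathSum_recurrence`, `closedSum_recurrence`). The coefficients `connCoeff` obey the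
matching recurrence, so `S(n, k)` is an explicit combination of the `S(0, k+i)`
(`closedSum_eq_sum`).

Letting `n → ∞` by dominated convergence gives the conjugate pair. Inserting the Bailey pair yields
an absolutely convergent double series, whose two orders of summation are the two sides of the
theorem. -/

theorem qPoch_succ (q a : ℂ) (n : ℕ) : qPoch q a (n + 1) = qPoch q a n * (1 - a * q ^ n) := by
  simp [qPoch, Finset.prod_range_succ]

theorem qPoch_self_succ (q : ℂ) (n : ℕ) :
    qPoch q q (n + 1) = qPoch q q n * (1 - q ^ (n + 1)) := by
  rw [qPoch_succ, pow_succ']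

@[simp] theorem qPoch_zero (q a : ℂ) : qPoch q a 0 = 1 := by simp [qPoch]

theorem one_sub_pow_ne_zero (hq1 : ‖q‖ < 1) (n : ℕ) : 1 - q ^ (n + 1) ≠ 0 := by
  intro h
  have h1 : ‖q ^ (n + 1)‖ = 1 := by rw [← sub_eq_zero.mp h, norm_one]
  rw [norm_pow] at h1
  exact absurd h1 (pow_lt_one₀ (norm_nonneg q) hq1 n.succ_ne_zero).ne

theorem qPoch_self_ne_zero (hq1 : ‖q‖ < 1) (n : ℕ) : qPoch q q n ≠ 0 := by
  induction n with
  | zero => simp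
  | succ n ih => rw [qPoch_self_succ]; exact mul_ne_zero ih (one_sub_pow_ne_zero hq1 n)

/-- `(q)_{ℓ+n} = (q)_ℓ (q^{ℓ+1})_n`. -/
theorem qPoch_self_add (q : ℂ) (l n : ℕ) :
    qPoch q q (l + n) = qPoch q q l * qPoch q (q ^ (l + 1)) n := by
  induction n with
  | zero => simp
  | succ n ih =>
    rw [← add_assoc, qPoch_self_succ, ih, qPoch_succ, mul_assoc]
    congr 3
    ring

theorem summable_mul_pow (hq1 : ‖q‖ < 1) (a : ℂ) : Summable fun k : ℕ => ‖-(a * q ^ k)‖ := by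
  simp only [norm_neg, norm_mul, norm_pow]
  exact (summable_geometric_of_lt_one (norm_nonneg q) hq1).mul_left _

theorem tendsto_qPoch (hq1 : ‖q‖ < 1) (a : ℂ) :
    Tendsto (qPoch q a) atTop (𝓝 (qPochInf q a)) := by
  have h := (multipliable_one_add_of_summable (summable_mul_pow hq1 a)).tendsto_prod_tprod_nat
  simp only [← sub_eq_add_neg] at h
  exact h

theorem qPochInf_self_ne_zero (hq1 : ‖q‖ < 1) : qPochInf q q ≠ 0 := by
  have h := tprod_one_add_ne_zero_of_summable (f := fun k : ℕ => -(q * q ^ k))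
    (fun k => by simpa only [← sub_eq_add_neg, ← pow_succ'] using one_sub_pow_ne_zero hq1 k)
    (summable_mul_pow hq1 q)
  simp only [← sub_eq_add_neg] at h
  exact h

theorem qPochInf_self_eq (hq1 : ‖q‖ < 1) (l : ℕ) :
    qPochInf q q = qPoch q q l * qPochInf q (q ^ (l + 1)) := by
  refine tendsto_nhds_unique
    ((tendsto_qPoch hq1 q).comp (tendsto_add_atTop_nat l)) ?_
  have h := (tendsto_qPoch hq1 (q ^ (l + 1))).const_mul (qPoch q q l)
  refine h.congr fun n => ?_
  simp only [Function.comp]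
  rw [← qPoch_self_add, add_comm]

theorem qPoch_self_bounds (hq1 : ‖q‖ < 1) :
    ∃ B : ℝ, 1 ≤ B ∧ ∀ n, ‖qPoch q q n‖ ≤ B ∧ ‖(qPoch q q n)⁻¹‖ ≤ B := by
  obtain ⟨B₁, h₁⟩ := (Metric.isBounded_range_of_tendsto _ (tendsto_qPoch hq1 q)).exists_norm_le
  obtain ⟨B₂, h₂⟩ := (Metric.isBounded_range_of_tendsto _
    ((tendsto_qPoch hq1 q).inv₀ (qPochInf_self_ne_zero hq1))).exists_norm_le
  refine ⟨max 1 (max B₁ B₂), le_max_left _ _, fun n => ⟨?_, ?_⟩⟩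
  · exact (h₁ _ ⟨n, rfl⟩).trans ((le_max_left _ _).trans (le_max_right _ _))
  · exact (h₂ _ ⟨n, rfl⟩).trans ((le_max_right _ _).trans (le_max_right _ _))

theorem gauss_zero_right (hq1 : ‖q‖ < 1) (A : ℕ) : gauss q A 0 = 1 := by
  simp [gauss, div_self (qPoch_self_ne_zero hq1 A)]

theorem gauss_self (hq1 : ‖q‖ < 1) (A : ℕ) : gauss q A A = 1 := by
  simp [gauss, div_self (qPoch_self_ne_zero hq1 A)]

theorem gauss_succ_succ (hq1 : ‖q‖ < 1) (A B : ℕ) :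
    gauss q (A + 1) (B + 1) = gauss q A B + q ^ (B + 1) * gauss q A (B + 1) := by
  rcases lt_trichotomy A B with h | h | h
  · simp [gauss, h.not_ge, show ¬ B + 1 ≤ A by omega]
  · subst h
    rw [gauss_self hq1, gauss_self hq1, gauss, if_neg (by omega), mul_zero, add_zero]
  · obtain ⟨c, rfl⟩ := Nat.exists_eq_add_of_lt h
    have e1 : B + c + 1 + 1 - (B + 1) = c + 1 := by omega
    have e2 : B + c + 1 - B = c + 1 := by omega
    have e3 : B + c + 1 - (B + 1) = c := by omega
    have i1 : B + 1 ≤ B + c + 1 + 1 := by omega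
    have i2 : B ≤ B + c + 1 := by omega
    have i3 : B + 1 ≤ B + c + 1 := by omega
    simp only [gauss, e1, e2, e3, i1, i2, i3, if_true]
    rw [qPoch_self_succ q (B + c + 1), qPoch_self_succ q B, qPoch_self_succ q c]
    have := qPoch_self_ne_zero hq1 B
    have := qPoch_self_ne_zero hq1 c
    have := one_sub_pow_ne_zero hq1 B
    have := one_sub_pow_ne_zero hq1 c
    field_simp
    ring

theorem norm_gauss_le (hq1 : ‖q‖ < 1) : ∃ B : ℝ, 1 ≤ B ∧ ∀ m n, ‖gauss q m n‖ ≤ B := by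
  obtain ⟨B, hB, h⟩ := qPoch_self_bounds hq1
  refine ⟨B * (B * B), one_le_mul_of_one_le_of_one_le hB (one_le_mul_of_one_le_of_one_le hB hB),
    fun m n => ?_⟩
  unfold gauss
  split_ifs
  · rw [div_eq_mul_inv, mul_inv, norm_mul, norm_mul]
    gcongr
    · exact (h _).1
    · exact (h _).2
    · exact (h _).2
  · rw [norm_zero]; positivity

/-- The Gaussian polynomial with integer arguments, zero unless `0 ≤ r ≤ T`. -/
noncomputable def gaussInt (q : ℂ) (T r : ℤ) : ℂ :=
  if 0 ≤ r ∧ r ≤ T then gauss q T.toNat r.toNat else 0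

theorem gaussInt_natCast (q : ℂ) (T r : ℕ) : gaussInt q T r = gauss q T r := by
  by_cases h : r ≤ T <;> simp [gaussInt, gauss, h]

theorem gaussInt_eq_zero (q : ℂ) {T r : ℤ} (h : r < 0 ∨ T < r) : gaussInt q T r = 0 :=
  if_neg (by omega)

theorem le_of_gaussInt_ne_zero {T r : ℤ} (h : gaussInt q T r ≠ 0) : 0 ≤ r ∧ r ≤ T := by
  by_contra h'
  exact h (if_neg h')

theorem gaussInt_pascal (hq1 : ‖q‖ < 1) {T : ℤ} (hT : 1 ≤ T) (r : ℤ) :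
    gaussInt q T r = gaussInt q (T - 1) (r - 1) + q ^ r * gaussInt q (T - 1) r := by
  rcases lt_trichotomy r 0 with h | rfl | h
  · rw [gaussInt_eq_zero q (Or.inl h), gaussInt_eq_zero q (Or.inl h),
      gaussInt_eq_zero q (Or.inl (by omega))]
    simp
  · obtain ⟨t, rfl⟩ : ∃ t : ℕ, T = t + 1 := ⟨(T - 1).toNat, by omega⟩
    have h1 := gaussInt_natCast q (t + 1) 0
    have h2 := gaussInt_natCast q t 0
    push_cast at h1 h2
    rw [gaussInt_eq_zero q (r := 0 - 1) (by omega), h1, add_sub_cancel_right, h2]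
    simp [gauss_zero_right hq1]
  · obtain ⟨t, rfl⟩ : ∃ t : ℕ, T = t + 1 := ⟨(T - 1).toNat, by omega⟩
    obtain ⟨s, rfl⟩ : ∃ s : ℕ, r = s + 1 := ⟨(r - 1).toNat, by omega⟩
    have h1 := gaussInt_natCast q (t + 1) (s + 1)
    have h2 := gaussInt_natCast q t (s + 1)
    push_cast at h1 h2
    rw [h1, add_sub_cancel_right, add_sub_cancel_right, gaussInt_natCast, h2, gauss_succ_succ hq1]
    norm_cast

theorem norm_gaussInt_le (hq1 : ‖q‖ < 1) : ∃ B : ℝ, 1 ≤ B ∧ ∀ T r, ‖gaussInt q T r‖ ≤ B := by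
  obtain ⟨B, hB, h⟩ := norm_gauss_le hq1
  refine ⟨B, hB, fun T r => ?_⟩
  unfold gaussInt
  split_ifs
  · exact h _ _
  · rw [norm_zero]; positivity

/-- The difference `e` of the two entries stays fixed, so the two growing factorials cancel in the
limit; this turns a Gaussian factor into `1 / (q)_e`. -/
theorem tendsto_gaussInt (hq1 : ‖q‖ < 1) (e : ℕ) (a b : ℤ) (hab : a = b + e) :
    Tendsto (fun n : ℕ => gaussInt q (n + a) (n + b)) atTop (𝓝 (qPoch q q e)⁻¹) := by
  have hP := tendsto_qPoch hq1 q
  have key : Tendsto (fun n : ℕ => qPoch q q ((n : ℤ) + a).toNat /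
      (qPoch q q ((n : ℤ) + b).toNat * qPoch q q e)) atTop
      (𝓝 (qPochInf q q / (qPochInf q q * qPoch q q e))) := by
    have ht : ∀ z : ℤ, Tendsto (fun n : ℕ => ((n : ℤ) + z).toNat) atTop atTop := by
      intro z
      refine tendsto_atTop.mpr fun m => ?_
      filter_upwards [eventually_ge_atTop (m + z.natAbs)] with n hn
      omega
    exact (hP.comp (ht a)).div ((hP.comp (ht b)).mul tendsto_const_nhds)
      (mul_ne_zero (qPochInf_self_ne_zero hq1) (qPoch_self_ne_zero hq1 e))
  have e1 : qPochInf q q / (qPochInf q q * qPoch q q e) = (qPoch q q e)⁻¹ := by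
    have := qPochInf_self_ne_zero hq1
    have := qPoch_self_ne_zero hq1 e
    field_simp
  rw [e1] at key
  refine key.congr' ?_
  filter_upwards [eventually_ge_atTop b.natAbs] with n hn
  have h1 : 0 ≤ (n : ℤ) + b ∧ (n : ℤ) + b ≤ n + a := by omega
  have h2 : ((n : ℤ) + b).toNat ≤ ((n : ℤ) + a).toNat := by omega
  have h3 : ((n : ℤ) + a).toNat - ((n : ℤ) + b).toNat = e := by omega
  rw [gaussInt, if_pos h1, gauss, if_pos h2, h3]

end Pochhammer

/-! ### Weighted path sums and their recurrence -/

section PathSum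

variable {q : ℂ} {lam : ℕ → ℤ}

/-- The exponent attached to the step from position `j` to position `j + 1` of a path. -/
def stepExp (lam : ℕ → ℤ) (j : ℕ) (d : ℤ) : ℤ := d ^ 2 + (lam (j + 1) - lam j) * d

/-- The sum over all integer paths `0 = K_0, K_1, …, K_j = A, K_{j+1} = B` of the weights of the
interior vertices, each taken with the step that leads to it. -/
noncomputable def pathSum (q : ℂ) (lam : ℕ → ℤ) (n : ℤ) : ℕ → ℤ → ℤ → ℂ
  | 0, A, _ => if A = 0 then 1 else 0
  | j + 1, B, C => ∑' A : ℤ, q ^ stepExp lam j (B - A) *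
      gaussInt q (n + A + C + lam (j + 1)) (n + 2 * B + lam (j + 1)) * pathSum q lam n j A B

theorem exists_of_pathSum_succ_ne_zero {n : ℤ} {j : ℕ} {B C : ℤ}
    (h : pathSum q lam n (j + 1) B C ≠ 0) :
    ∃ A, pathSum q lam n j A B ≠ 0 ∧ 0 ≤ n + 2 * B + lam (j + 1) ∧ 2 * B ≤ A + C := by
  rw [pathSum] at h
  by_contra! hA
  refine h ((tsum_congr fun A => ?_).trans tsum_zero)
  by_cases h1 : pathSum q lam n j A B = 0
  · rw [h1, mul_zero]
  · have := hA A h1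
    rw [gaussInt_eq_zero q (by by_contra! h2; exact absurd (this (by omega)) (by omega))]
    ring

/-- A nonzero Gaussian factor forces `2B ≤ A + C`, so contributing paths are convex and start at 0,
whence `K_j / j` is nondecreasing. With the lower bound below, all sums over paths are finite. -/
theorem pathSum_support_upper {n : ℤ} {j : ℕ} {A B : ℤ} (h : pathSum q lam n j A B ≠ 0) :
    (j + 1) * A ≤ j * B := by
  induction j generalizing A B with
  | zero =>
    have : A = 0 := by by_contra h0; exact h (by simp [pathSum, h0])
    simp [this]
  | succ j ih =>
    obtain ⟨A', h1, -, h2⟩ := exists_of_pathSum_succ_ne_zero h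
    have h3 := ih h1
    push_cast
    nlinarith

theorem pathSum_support_lower {n : ℤ} {j : ℕ} {A B : ℤ} (h : pathSum q lam n j A B ≠ 0) :
    A = 0 ∧ j = 0 ∨ 0 ≤ n + 2 * A + lam j := by
  cases j with
  | zero => left; exact ⟨by by_contra h0; exact h (by simp [pathSum, h0]), rfl⟩
  | succ j =>
    obtain ⟨A', -, h1, -⟩ := exists_of_pathSum_succ_ne_zero h
    exact Or.inr h1

theorem summable_mul_pathSum (q : ℂ) (lam : ℕ → ℤ) (n : ℤ) (j : ℕ) (B : ℤ) (f : ℤ → ℂ) :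
    Summable fun A => f A * pathSum q lam n j A B := by
  refine summable_of_hasFiniteSupport
    ((Set.finite_Icc (-(|n| + |lam j|)) (|B|)).subset fun A hA => ?_)
  have hA := right_ne_zero_of_mul hA
  have h1 := pathSum_support_upper hA
  have h2 := pathSum_support_lower hA
  have h3 := le_abs_self n
  have h4 := le_abs_self (lam j)
  have h5 := abs_nonneg n
  have h6 := abs_nonneg (lam j)
  have h7 := le_abs_self B
  have h8 := abs_nonneg B
  refine Set.mem_Icc.mpr ⟨by omega, ?_⟩
  by_contra! h9
  have : (j : ℤ) * B ≤ j * |B| := by gcongr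
  have : ((j : ℤ) + 1) * |B| < (j + 1) * A := by gcongr
  linarith

theorem summable_mul_pathSum_shift (q : ℂ) (lam : ℕ → ℤ) (n : ℤ) (j : ℕ) (B : ℤ) (f : ℤ → ℂ) :
    Summable fun A => f A * pathSum q lam n j (A + 1) B := by
  have h := (Equiv.addRight (1 : ℤ)).summable_iff.mpr
    (summable_mul_pathSum q lam n j B fun A => f (A - 1))
  simpa [Function.comp_def] using h

theorem tsum_shift (f : ℤ → ℂ) : ∑' A, f (A + 1) = ∑' A, f A :=
  (Equiv.addRight (1 : ℤ)).tsum_eq f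

/-- The coefficient recurrence used for the induction: the left side of the path recurrence, summed
against arbitrary coefficients, is rearranged so that only `pathSum q lam n` occurs. -/
theorem tsum_pathSum_rearrange {n : ℤ} {j : ℕ} (u w : ℤ → ℂ) (B : ℤ)
    (h : ∀ A, u A * (pathSum q lam (n + 1) j A B +
        (1 - q ^ n) * pathSum q lam (n - 1) j (A + 1) (B + 1)) =
      u A * (pathSum q lam n j A B + pathSum q lam n j (A + 1) (B + 1) -
        w (A + 1) * pathSum q lam n j (A + 1) B)) :
    ∑' A, u A * pathSum q lam (n + 1) j A B +
      (1 - q ^ n) * ∑' A, u (A - 1) * pathSum q lam (n - 1) j A (B + 1) =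
    ∑' A, (u A - u (A - 1) * w A) * pathSum q lam n j A B +
      ∑' A, u (A - 1) * pathSum q lam n j A (B + 1) := by
  rw [← tsum_shift (fun A => u (A - 1) * pathSum q lam (n - 1) j A (B + 1)),
    ← tsum_shift (fun A => u (A - 1) * pathSum q lam n j A (B + 1)), ← tsum_mul_left,
    ← Summable.tsum_add (summable_mul_pathSum ..)
      ((by simpa using (summable_mul_pathSum_shift ..).mul_left _))]
  have e : ∑' A, (u A - u (A - 1) * w A) * pathSum q lam n j A B =
      ∑' A, u A * pathSum q lam n j A B -
        ∑' A, u A * w (A + 1) * pathSum q lam n j (A + 1) B := by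
    rw [show (fun A => u A * w (A + 1) * pathSum q lam n j (A + 1) B) =
      fun A => (fun A' => u (A' - 1) * w A' * pathSum q lam n j A' B) (A + 1) by
        funext A; simp, tsum_shift (fun A' => u (A' - 1) * w A' * pathSum q lam n j A' B),
      ← Summable.tsum_sub (summable_mul_pathSum ..) (summable_mul_pathSum ..)]
    exact tsum_congr fun A => by ring
  rw [e, ← Summable.tsum_sub (summable_mul_pathSum ..) (summable_mul_pathSum_shift ..),
    ← Summable.tsum_add ((summable_mul_pathSum ..).sub (summable_mul_pathSum_shift ..))
      (by simpa using summable_mul_pathSum_shift ..)]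
  refine tsum_congr fun A => ?_
  have := h A
  simp only [add_sub_cancel_right]
  linear_combination this

theorem stepExp_succ (lam : ℕ → ℤ) (j : ℕ) (d : ℤ) :
    stepExp lam j (d + 1) = stepExp lam j d + 2 * d + 1 + (lam (j + 1) - lam j) := by
  unfold stepExp; ring

/-- Induction on the length. On the right, the `q`-Pascal rule is applied at the newly added vertex;
on the left, the recurrence for the shorter path is inserted through `tsum_pathSum_rearrange`. The
term in `(A + 1, B)` occurs because the last step of an open path carries no weight yet. -/
theorem pathSum_recurrence (hq0 : q ≠ 0) (hq1 : ‖q‖ < 1)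
    (hconc : ∀ j, lam j + lam (j + 2) ≤ 2 * lam (j + 1)) (h0 : lam 0 = 0)
    {n : ℤ} (hn : 0 ≤ n) (j : ℕ) (A B : ℤ) (hB : 0 ≤ n + 1 + 2 * B + lam (j + 1)) :
    pathSum q lam (n + 1) j A B + (1 - q ^ n) * pathSum q lam (n - 1) j (A + 1) (B + 1) =
      pathSum q lam n j A B + pathSum q lam n j (A + 1) (B + 1) -
        q ^ (n + 2 * (A + 1) + lam j) * pathSum q lam n j (A + 1) B := by
  induction j generalizing A B with
  | zero =>
    simp only [pathSum, h0]
    by_cases hA : A + 1 = 0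
    · simp [hA, add_sub_assoc]
    · simp [hA]
  | succ j ih =>
    rename' A => B, B => C
    have pascal : ∀ A, ∀ B', pathSum q lam n j A B' ≠ 0 → ∀ r,
        gaussInt q (n + 1 + A + C + lam (j + 1)) r = gaussInt q (n + A + C + lam (j + 1)) (r - 1) +
          q ^ r * gaussInt q (n + A + C + lam (j + 1)) r := by
      intro A B' hA r
      have h1 := pathSum_support_lower hA
      have h2 := hconc j
      -- Adding the bounds for `A` and `C` and using concavity gives `2(n + A + C + lam (j+1)) + 1 ≥
      -- 0`; integrality removes the 1.
      have hT : 1 ≤ n + 1 + A + C + lam (j + 1) := by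
        rcases h1 with ⟨h1, h3⟩ | h1
        · subst h3; simp only [zero_add, Nat.reduceAdd] at *; omega
        · simp only [add_assoc, Nat.reduceAdd] at hB; omega
      rw [gaussInt_pascal hq1 hT,
        show n + 1 + A + C + lam (j + 1) - 1 = n + A + C + lam (j + 1) by ring]
    have hre := tsum_pathSum_rearrange (q := q) (lam := lam) (n := n) (j := j)
      (fun A => q ^ stepExp lam j (B - A) *
        gaussInt q (n + 1 + A + C + lam (j + 1)) (n + 1 + 2 * B + lam (j + 1)))
      (fun A => q ^ (n + 2 * A + lam j)) B (fun A => by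
        -- For a negative lower entry the coefficient itself vanishes, so the induction hypothesis
        -- is needed only where it applies.
        by_cases hr : 0 ≤ n + 1 + 2 * B + lam (j + 1)
        · rw [ih A B hr]
        · rw [gaussInt_eq_zero q (Or.inl (by omega))]
          ring)
    have e1 : pathSum q lam (n + 1) (j + 1) B C = ∑' A, (q ^ stepExp lam j (B - A) *
        gaussInt q (n + 1 + A + C + lam (j + 1)) (n + 1 + 2 * B + lam (j + 1))) *
          pathSum q lam (n + 1) j A B := rfl
    have e2 : pathSum q lam (n - 1) (j + 1) (B + 1) (C + 1) =
        ∑' A, (q ^ stepExp lam j (B - (A - 1)) *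
        gaussInt q (n + 1 + (A - 1) + C + lam (j + 1)) (n + 1 + 2 * B + lam (j + 1))) *
          pathSum q lam (n - 1) j A (B + 1) := by
      rw [pathSum]
      refine tsum_congr fun A => ?_
      rw [show n - 1 + A + (C + 1) + lam (j + 1) = n + 1 + (A - 1) + C + lam (j + 1) by ring,
        show n - 1 + 2 * (B + 1) + lam (j + 1) = n + 1 + 2 * B + lam (j + 1) by ring,
        show B + 1 - A = B - (A - 1) by ring]
    have e3 : pathSum q lam n (j + 1) B C = ∑' A, (q ^ stepExp lam j (B - A) *
          gaussInt q (n + 1 + A + C + lam (j + 1)) (n + 1 + 2 * B + lam (j + 1)) -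
        q ^ stepExp lam j (B - (A - 1)) *
          gaussInt q (n + 1 + (A - 1) + C + lam (j + 1)) (n + 1 + 2 * B + lam (j + 1)) *
          q ^ (n + 2 * A + lam j)) * pathSum q lam n j A B := by
      rw [pathSum]
      refine tsum_congr fun A => ?_
      by_cases hA : pathSum q lam n j A B = 0
      · rw [hA]; ring
      congr 1
      rw [pascal A B hA (n + 1 + 2 * B + lam (j + 1)),
        show B - (A - 1) = B - A + 1 by ring, stepExp_succ,
        show n + 1 + (A - 1) + C + lam (j + 1) = n + A + C + lam (j + 1) by ring,
        show n + 1 + 2 * B + lam (j + 1) - 1 = n + 2 * B + lam (j + 1) by ring]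
      -- This equality of exponents cancels the second Pascal term against the shifted one.
      have : q ^ (stepExp lam j (B - A) + 2 * (B - A) + 1 + (lam (j + 1) - lam j)) *
          q ^ (n + 2 * A + lam j) =
          q ^ stepExp lam j (B - A) * q ^ (n + 1 + 2 * B + lam (j + 1)) := by
        rw [← zpow_add₀ hq0, ← zpow_add₀ hq0]
        congr 1; ring
      linear_combination
        gaussInt q (n + A + C + lam (j + 1)) (n + 1 + 2 * B + lam (j + 1)) * this
    have e4 : pathSum q lam n (j + 1) (B + 1) (C + 1) -
        q ^ (n + 2 * (B + 1) + lam (j + 1)) * pathSum q lam n (j + 1) (B + 1) C =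
        ∑' A, (q ^ stepExp lam j (B - (A - 1)) *
          gaussInt q (n + 1 + (A - 1) + C + lam (j + 1)) (n + 1 + 2 * B + lam (j + 1))) *
          pathSum q lam n j A (B + 1) := by
      rw [pathSum, pathSum, ← tsum_mul_left,
        ← Summable.tsum_sub (summable_mul_pathSum ..) ((summable_mul_pathSum ..).mul_left _)]
      refine tsum_congr fun A => ?_
      by_cases hA : pathSum q lam n j A (B + 1) = 0
      · rw [hA]; ring
      have := pascal A (B + 1) hA (n + 2 * (B + 1) + lam (j + 1))
      rw [show n + A + (C + 1) + lam (j + 1) = n + 1 + A + C + lam (j + 1) by ring, this,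
        show n + 1 + (A - 1) + C + lam (j + 1) = n + A + C + lam (j + 1) by ring,
        show B - (A - 1) = B + 1 - A by ring,
        show n + 2 * (B + 1) + lam (j + 1) - 1 = n + 1 + 2 * B + lam (j + 1) by ring]
      ring
    rw [add_sub_assoc, e4, e3, e2, e1]
    exact hre

/-- The sum over all integer paths from `0` to `k` with `d` interior vertices. -/
noncomputable def closedSum (q : ℂ) (lam : ℕ → ℤ) (d : ℕ) (n k : ℤ) : ℂ :=
  ∑' A, q ^ stepExp lam d (k - A) * pathSum q lam n d A k

/-- Weighting the final step and summing over its starting point merges the `(A + 1, B)` term with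
the first one: the shift in `A` changes the step weight by exactly the power that makes the total
factor independent of `A`. -/
theorem closedSum_recurrence (hq0 : q ≠ 0) (hq1 : ‖q‖ < 1)
    (hconc : ∀ j, lam j + lam (j + 2) ≤ 2 * lam (j + 1)) (h0 : lam 0 = 0) (d : ℕ)
    {n k : ℤ} (hn : 0 ≤ n) (hk : 0 ≤ n + 1 + 2 * k + lam (d + 1)) :
    closedSum q lam d (n + 1) k + (1 - q ^ n) * closedSum q lam d (n - 1) (k + 1) =
      (1 - q ^ (n + 1 + 2 * k + lam (d + 1))) * closedSum q lam d n k +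
        closedSum q lam d n (k + 1) := by
  have hre := tsum_pathSum_rearrange (q := q) (lam := lam) (n := n) (j := d)
      (fun A => q ^ stepExp lam d (k - A)) (fun A => q ^ (n + 2 * A + lam d)) k
      (fun A => by rw [pathSum_recurrence hq0 hq1 hconc h0 hn d A k hk])
  have e1 : ∀ n', ∑' A, q ^ stepExp lam d (k - (A - 1)) * pathSum q lam n' d A (k + 1) =
      closedSum q lam d n' (k + 1) := fun n' => tsum_congr fun A => by congr 3; ring
  have e2 : ∑' A, (q ^ stepExp lam d (k - A) -
      q ^ stepExp lam d (k - (A - 1)) * q ^ (n + 2 * A + lam d)) * pathSum q lam n d A k =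
      (1 - q ^ (n + 1 + 2 * k + lam (d + 1))) * closedSum q lam d n k := by
    rw [closedSum, ← tsum_mul_left]
    refine tsum_congr fun A => ?_
    rw [show k - (A - 1) = k - A + 1 by ring, stepExp_succ, ← zpow_add₀ hq0,
      show stepExp lam d (k - A) + 2 * (k - A) + 1 + (lam (d + 1) - lam d) + (n + 2 * A + lam d) =
        (n + 1 + 2 * k + lam (d + 1)) + stepExp lam d (k - A) by ring, zpow_add₀ hq0]
    ring
  rw [e1, e1, e2] at hre
  exact hre

end PathSum

/-! ### Expansion of `S(n, k)` in the values `S(0, k + i)` -/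

section FiniteIdentity

variable {q : ℂ} {lam : ℕ → ℤ}

/-- The connection coefficient
`(q)_n (q)_{n+w} / ((q)_{n-i} (q)_i (q)_{i+w})`. -/
noncomputable def connCoeff (q : ℂ) (n w i : ℕ) : ℂ :=
  gauss q n i * (qPoch q q (n + w) / qPoch q q (i + w))

theorem connCoeff_of_lt (q : ℂ) {n i : ℕ} (w : ℕ) (h : n < i) : connCoeff q n w i = 0 := by
  rw [connCoeff, gauss, if_neg (by omega), zero_mul]

theorem connCoeff_self (hq1 : ‖q‖ < 1) (n w : ℕ) : connCoeff q n w n = 1 := by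
  rw [connCoeff, gauss_self hq1, div_self (qPoch_self_ne_zero hq1 _), one_mul]

theorem connCoeff_succ_zero (hq1 : ‖q‖ < 1) (n w : ℕ) :
    connCoeff q (n + 1) w 0 = (1 - q ^ (n + 1 + w)) * connCoeff q n w 0 := by
  rw [connCoeff, connCoeff, gauss_zero_right hq1, gauss_zero_right hq1,
    show n + 1 + w = n + w + 1 by ring, qPoch_self_succ]
  ring

/-- This mirrors `closedSum_recurrence`: replacing `k` by `k + 1` raises `w = 2k + ℓ` by 2 and
lowers `i` by 1. -/
theorem connCoeff_succ_succ (hq1 : ‖q‖ < 1) (n w i : ℕ) :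
    connCoeff q (n + 1) w (i + 1) = (1 - q ^ (n + 1 + w)) * connCoeff q n w (i + 1) +
      connCoeff q n (w + 2) i - (1 - q ^ n) * connCoeff q (n - 1) (w + 2) i := by
  rcases lt_trichotomy n i with h | rfl | h
  · rw [connCoeff_of_lt q _ (by omega), connCoeff_of_lt q _ (by omega),
      connCoeff_of_lt q _ (by omega), connCoeff_of_lt q _ (by omega)]
    ring
  · rw [connCoeff_self hq1, connCoeff_self hq1, connCoeff_of_lt q _ (by omega)]
    cases n with
    | zero => simp
    | succ n => rw [connCoeff_of_lt q _ (by omega)]; ring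
  · obtain ⟨c, rfl⟩ := Nat.exists_eq_add_of_lt h
    have i1 : i + 1 ≤ i + c + 1 + 1 := by omega
    have i2 : i + 1 ≤ i + c + 1 := by omega
    have i3 : i ≤ i + c + 1 := by omega
    have i4 : i ≤ i + c := by omega
    have e1 : i + c + 1 + 1 - (i + 1) = c + 1 := by omega
    have e2 : i + c + 1 - (i + 1) = c := by omega
    have e3 : i + c + 1 - i = c + 1 := by omega
    have e4 : i + c - i = c := by omega
    simp only [connCoeff, gauss, Nat.add_sub_cancel, i1, i2, i3, i4, e1, e2, e3, e4, if_true]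
    rw [show i + c + 1 + 1 + w = i + c + w + 2 by ring,
      show i + c + 1 + w = i + c + w + 1 by ring,
      show i + c + 1 + (w + 2) = i + c + w + 3 by ring,
      show i + c + (w + 2) = i + c + w + 2 by ring,
      show i + 1 + w = i + w + 1 by ring, show i + (w + 2) = i + w + 2 by ring]
    rw [qPoch_self_succ q (i + c + 1), qPoch_self_succ q (i + c), qPoch_self_succ q i,
      qPoch_self_succ q c, qPoch_self_succ q (i + c + w + 2), qPoch_self_succ q (i + c + w + 1),
      qPoch_self_succ q (i + w + 1)]
    have := qPoch_self_ne_zero hq1 i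
    have := qPoch_self_ne_zero hq1 c
    have := qPoch_self_ne_zero hq1 (i + w + 1)
    have := one_sub_pow_ne_zero hq1 i
    have := one_sub_pow_ne_zero hq1 c
    have := one_sub_pow_ne_zero hq1 (i + w + 1)
    field_simp
    ring

theorem sum_connCoeff_recurrence (hq1 : ‖q‖ < 1) (f : ℕ → ℂ) (n w : ℕ) :
    ∑ i ∈ range (n + 2), f i * connCoeff q (n + 1) w i =
      (1 - q ^ (n + 1 + w)) * ∑ i ∈ range (n + 1), f i * connCoeff q n w i +
      ∑ i ∈ range (n + 1), f (i + 1) * connCoeff q n (w + 2) i -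
      (1 - q ^ n) * ∑ i ∈ range (n - 1 + 1), f (i + 1) * connCoeff q (n - 1) (w + 2) i := by
  have h1 : ∑ i ∈ range (n + 1), f i * connCoeff q n w i =
      ∑ i ∈ range (n + 2), f i * connCoeff q n w i := by
    rw [sum_range_succ _ (n + 1), connCoeff_of_lt q _ (by omega : n < n + 1)]
    ring
  -- At `n = 0` the truncated `n - 1` is harmless because `1 - q ^ n` vanishes.
  have h2 : (1 - q ^ n) * ∑ i ∈ range (n - 1 + 1), f (i + 1) * connCoeff q (n - 1) (w + 2) i =
      (1 - q ^ n) * ∑ i ∈ range (n + 1), f (i + 1) * connCoeff q (n - 1) (w + 2) i := by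
    cases n with
    | zero => simp
    | succ n =>
      rw [sum_range_succ _ (n + 1), Nat.add_sub_cancel,
        connCoeff_of_lt q _ (by omega : n < n + 1)]
      ring
  rw [h1, h2, sum_range_succ' _ (n + 1), sum_range_succ' _ (n + 1), mul_add, mul_sum, mul_sum,
    connCoeff_succ_zero hq1]
  simp_rw [connCoeff_succ_succ hq1 n w]
  have : ∀ i, f (i + 1) * ((1 - q ^ (n + 1 + w)) * connCoeff q n w (i + 1) +
      connCoeff q n (w + 2) i - (1 - q ^ n) * connCoeff q (n - 1) (w + 2) i) =
      (1 - q ^ (n + 1 + w)) * (f (i + 1) * connCoeff q n w (i + 1)) +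
      f (i + 1) * connCoeff q n (w + 2) i -
      (1 - q ^ n) * (f (i + 1) * connCoeff q (n - 1) (w + 2) i) := fun i => by ring
  simp_rw [this, sum_sub_distrib, sum_add_distrib]
  ring

theorem closedSum_eq_sum (hq0 : q ≠ 0) (hq1 : ‖q‖ < 1)
    (hconc : ∀ j, lam j + lam (j + 2) ≤ 2 * lam (j + 1)) (h0 : lam 0 = 0) (d l : ℕ)
    (hl : lam (d + 1) = l) (n k : ℕ) :
    closedSum q lam d n k = ∑ i ∈ range (n + 1),
      closedSum q lam d 0 ((k + i : ℕ) : ℤ) * connCoeff q n (2 * k + l) i := by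
  induction n using Nat.strong_induction_on generalizing k with
  | _ n ih =>
    cases n with
    | zero => simp [connCoeff_self hq1]
    | succ n =>
      have hrec := closedSum_recurrence hq0 hq1 hconc h0 d (n := n) (k := k) (by omega)
        (by omega)
      have i1 := ih n (by omega) k
      have i2 := ih n (by omega) (k + 1)
      have i3 : (1 - q ^ n) * closedSum q lam d ((n : ℤ) - 1) ((k : ℤ) + 1) = (1 - q ^ n) *
          ∑ i ∈ range (n - 1 + 1), closedSum q lam d 0 ((k + (i + 1) : ℕ) : ℤ) *
            connCoeff q (n - 1) (2 * k + l + 2) i := by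
        cases n with
        | zero => simp
        | succ n =>
          have := ih n (by omega) (k + 1)
          push_cast at this
          rw [show 2 * (k + 1) + l = 2 * k + l + 2 by ring] at this
          rw [Nat.add_sub_cancel]
          push_cast
          rw [add_sub_cancel_right, this]
          congr 1
          refine sum_congr rfl fun i _ => ?_
          congr 2
          ring
      rw [hl, show (n : ℤ) + 1 + 2 * k + l = ((n + 1 + (2 * k + l) : ℕ) : ℤ) by push_cast; ring,
        zpow_natCast, zpow_natCast] at hrec
      rw [sum_connCoeff_recurrence hq1 (fun i => closedSum q lam d 0 ((k + i : ℕ) : ℤ)),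
        ← i1, ← i3]
      rw [show 2 * (k + 1) + l = 2 * k + l + 2 by ring] at i2
      have i2' : closedSum q lam d n ((k : ℤ) + 1) = ∑ i ∈ range (n + 1),
          closedSum q lam d 0 ((k + (i + 1) : ℕ) : ℤ) * connCoeff q n (2 * k + l + 2) i := by
        push_cast at i2 ⊢
        rw [i2]
        refine sum_congr rfl fun i _ => ?_
        congr 2
        ring
      rw [← i2']
      push_cast
      linear_combination hrec

end FiniteIdentity

/-! ### Convex integer paths -/

section ConvexPath

theorem convex_path_mul_le {d : ℕ} {K : ℕ → ℤ} (h0 : K 0 = 0)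
    (hK : ∀ i < d, 2 * K (i + 1) ≤ K i + K (i + 2)) {j : ℕ} (hj : j ≤ d) :
    (j + 1) * K j ≤ j * K (j + 1) := by
  induction j with
  | zero => simp [h0]
  | succ j ih =>
    have h1 := ih (by omega)
    have h2 := hK j (by omega)
    push_cast
    nlinarith

/-- Since `K_j / j` is nondecreasing, the bound descends from the endpoint. -/
theorem convex_path_le {d : ℕ} {K : ℕ → ℤ} (h0 : K 0 = 0)
    (hK : ∀ i < d, 2 * K (i + 1) ≤ K i + K (i + 2)) {j : ℕ} (hj : j ≤ d + 1) :
    K j ≤ max 0 (K (d + 1)) := by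
  induction hj using Nat.decreasingInduction with
  | self => exact le_max_right _ _
  | of_succ j hj ih =>
    have h1 := convex_path_mul_le h0 hK (j := j) (by omega)
    have h2 : (j : ℤ) * K (j + 1) ≤ (j + 1) * max 0 (K (d + 1)) := by
      have : (0 : ℤ) ≤ max 0 (K (d + 1)) := le_max_left _ _
      nlinarith
    exact le_of_mul_le_mul_left (h1.trans h2) (by positivity)

/-- The path `0, v_0, …, v_{d-1}, k, k, …`. -/
def pathExt {R : Type*} [Zero R] {d : ℕ} (v : Fin d → R) (k : R) (j : ℕ) : R :=
  if j = 0 then 0 else if h : j - 1 < d then v ⟨j - 1, h⟩ else k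

@[simp] theorem pathExt_zero {R : Type*} [Zero R] {d : ℕ} (v : Fin d → R) (k : R) : pathExt v k 0 = 0 := rfl

@[simp] theorem pathExt_fin {R : Type*} [Zero R] {d : ℕ} (v : Fin d → R) (k : R) (i : Fin d) :
    pathExt v k (i + 1) = v i := by
  simp [pathExt]

@[simp] theorem pathExt_last {R : Type*} [Zero R] {d : ℕ} (v : Fin d → R) (k : R) : pathExt v k (d + 1) = k := by
  simp [pathExt]

theorem pathExt_snoc {d : ℕ} (v : Fin d → ℤ) (B k : ℤ) {j : ℕ} (hj : j ≤ d + 1) :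
    pathExt (Fin.snoc v B : Fin (d + 1) → ℤ) k j = pathExt v B j := by
  unfold pathExt
  by_cases h0 : j = 0
  · simp [h0]
  · have h1 : j - 1 < d + 1 := by omega
    simp only [h0, h1, if_false, dif_pos, Fin.snoc]
    rfl

end ConvexPath

/-! ### Unrolling the recursion into sums over whole paths -/

section Unroll

variable {q : ℂ} {lam : ℕ → ℤ}

/-- The weight of the vertex at position `i + 1` of a path, with the step that leads to it. -/
noncomputable def vertexWeight (q : ℂ) (lam : ℕ → ℤ) (n : ℤ) (i : ℕ) (A B C : ℤ) : ℂ :=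
  q ^ stepExp lam i (B - A) * gaussInt q (n + A + C + lam (i + 1)) (n + 2 * B + lam (i + 1))

/-- The product of the weights of the interior vertices of a path. -/
noncomputable def pathWeight (q : ℂ) (lam : ℕ → ℤ) (n : ℤ) (d : ℕ) (K : ℕ → ℤ) : ℂ :=
  ∏ i ∈ range d, vertexWeight q lam n i (K i) (K (i + 1)) (K (i + 2))

theorem pathWeight_snoc (q : ℂ) (lam : ℕ → ℤ) (n : ℤ) {d : ℕ} (v : Fin d → ℤ) (B C : ℤ) :
    pathWeight q lam n (d + 1) (pathExt (Fin.snoc v B : Fin (d + 1) → ℤ) C) =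
      pathWeight q lam n d (pathExt v B) * vertexWeight q lam n d (pathExt v B d) B C := by
  rw [pathWeight, prod_range_succ]
  congr 1
  · refine prod_congr rfl fun i hi => ?_
    have := mem_range.mp hi
    rw [pathExt_snoc v B C (by omega), pathExt_snoc v B C (by omega),
      pathExt_snoc v B C (by omega)]
  · rw [pathExt_snoc v B C (by omega), pathExt_snoc v B C (by omega), pathExt_last, pathExt_last]

theorem finite_support_pathWeight (q : ℂ) (lam : ℕ → ℤ) (n : ℤ) (d : ℕ) (k : ℤ) :
    {v : Fin d → ℤ | pathWeight q lam n d (pathExt v k) ≠ 0}.Finite := by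
  refine (Set.finite_Icc (fun i : Fin d => -(|n| + |lam (i + 1)|))
    (fun _ : Fin d => max 0 k)).subset fun v hv => ?_
  have hg : ∀ i < d, 0 ≤ n + 2 * pathExt v k (i + 1) + lam (i + 1) ∧
      2 * pathExt v k (i + 1) ≤ pathExt v k i + pathExt v k (i + 2) := by
    intro i hi
    have h1 := prod_ne_zero_iff.mp hv i (mem_range.mpr hi)
    have h2 := le_of_gaussInt_ne_zero (right_ne_zero_of_mul h1)
    exact ⟨h2.1, by linarith [h2.2]⟩
  refine Set.mem_Icc.mpr ⟨fun i => ?_, fun i => ?_⟩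
  · have h1 := (hg i i.2).1
    rw [pathExt_fin] at h1
    have h3 := le_abs_self n
    have h4 := le_abs_self (lam (i + 1))
    have h5 := abs_nonneg n
    have h6 := abs_nonneg (lam (i + 1))
    show -(|n| + |lam (i + 1)|) ≤ v i
    omega
  · have := convex_path_le (pathExt_zero v k) (fun i hi => (hg i hi).2)
      (j := i + 1) (by omega)
    rwa [pathExt_fin, pathExt_last] at this

/-- The arbitrary function `h` of the last interior vertex makes the induction close: the weight of
the next vertex is such a function. -/
theorem tsum_mul_pathSum (q : ℂ) (lam : ℕ → ℤ) (n : ℤ) (d : ℕ) (k : ℤ) (h : ℤ → ℂ) :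
    ∑' A, h A * pathSum q lam n d A k =
      ∑' v : Fin d → ℤ, h (pathExt v k d) * pathWeight q lam n d (pathExt v k) := by
  induction d generalizing k h with
  | zero =>
    rw [tsum_eq_single 0 (fun A hA => by simp [pathSum, hA]),
      tsum_eq_single default (fun v hv => absurd (Subsingleton.elim _ _) hv)]
    simp [pathSum, pathWeight]
  | succ d ih =>
    have hs : Summable fun v : Fin (d + 1) → ℤ =>
        h (pathExt v k (d + 1)) * pathWeight q lam n (d + 1) (pathExt v k) :=
      summable_of_hasFiniteSupport
        ((finite_support_pathWeight q lam n (d + 1) k).subset fun v hv => right_ne_zero_of_mul hv)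
    obtain ⟨e, he⟩ : ∃ e : ℤ × (Fin d → ℤ) ≃ (Fin (d + 1) → ℤ),
        ∀ B v, e (B, v) = Fin.snoc v B := ⟨Fin.snocEquiv fun _ => ℤ, fun _ _ => rfl⟩
    rw [← e.tsum_eq, Summable.tsum_prod]
    · refine tsum_congr fun B => ?_
      have := ih B (fun A => vertexWeight q lam n d A B k)
      rw [show pathSum q lam n (d + 1) B k =
        ∑' A, vertexWeight q lam n d A B k * pathSum q lam n d A B from rfl, this, ← tsum_mul_left]
      refine tsum_congr fun v => ?_
      rw [he, pathWeight_snoc, pathExt_snoc v B k le_rfl, pathExt_last]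
      ring
    · have hs' := e.summable_iff.mpr hs
      simp only [Function.comp_def] at hs'
      exact hs'

theorem closedSum_eq_tsum (q : ℂ) (lam : ℕ → ℤ) (n : ℤ) (d : ℕ) (k : ℤ) :
    closedSum q lam d n k = ∑' v : Fin d → ℤ,
      q ^ stepExp lam d (k - pathExt v k d) * pathWeight q lam n d (pathExt v k) :=
  tsum_mul_pathSum q lam n d k fun A => q ^ stepExp lam d (k - A)

theorem closedSum_term_eq (hq0 : q ≠ 0) (lam : ℕ → ℤ) (n : ℤ) (d : ℕ) (K : ℕ → ℤ) :
    q ^ stepExp lam d (K (d + 1) - K d) * pathWeight q lam n d K =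
      q ^ (∑ i ∈ range (d + 1), stepExp lam i (K (i + 1) - K i)) *
        ∏ i : Fin d, gaussInt q (n + K i + K (i + 2) + lam (i + 1))
          (n + 2 * K (i + 1) + lam (i + 1)) := by
  have hz : ∀ s : Finset ℕ, q ^ (∑ i ∈ s, stepExp lam i (K (i + 1) - K i)) =
      ∏ i ∈ s, q ^ stepExp lam i (K (i + 1) - K i) := by
    intro s
    induction s using Finset.induction_on with
    | empty => simp
    | insert a s ha ih => rw [sum_insert ha, prod_insert ha, zpow_add₀ hq0, ih]
  rw [hz, prod_range_succ, pathWeight]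
  simp only [vertexWeight, prod_mul_distrib]
  rw [← Fin.prod_univ_eq_prod_range (fun i => gaussInt q (n + K i + K (i + 2) + lam (i + 1))
          (n + 2 * K (i + 1) + lam (i + 1)))]
  ring

end Unroll

/-! ### The Cartan matrix as a discrete Laplacian -/

section Cartan

variable {N : ℕ}

theorem dotProduct_unitVec (v : Fin (N - 1) → ℚ) (p : ℕ) :
    v ⬝ᵥ unitVec N p = pathExt v 0 p := by
  simp only [dotProduct, unitVec, mul_ite, mul_one, mul_zero]
  by_cases h0 : p = 0
  · subst h0; simp
  by_cases h : p - 1 < N - 1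
  · rw [sum_eq_single ⟨p - 1, h⟩ (fun j _ hj => if_neg fun e => hj (Fin.ext (by simp; omega)))
      (by simp)]
    rw [if_pos (by simp; omega), pathExt, if_neg h0, dif_pos h]
  · rw [pathExt, if_neg h0, dif_neg h]
    exact sum_eq_zero fun j _ => if_neg (by omega)

/-- The boundary value `c` at position `N` is free, with a correction in the last row only: `c = 0`
serves `C⁻¹η` and `c = 2L + ℓ` the `(m, n)`-system. -/
theorem cartan_mulVec_apply (v : Fin (N - 1) → ℚ) (c : ℚ) (i : Fin (N - 1)) :
    (cartan N *ᵥ v) i = 2 * pathExt v c (i + 1) - pathExt v c i - pathExt v c (i + 2) +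
      c * unitVec N (N - 1) i := by
  have h1 : (incidence N *ᵥ v) i =
      pathExt v c i + pathExt v c (i + 2) - c * unitVec N (N - 1) i := by
    have e : (incidence N *ᵥ v) i =
        v ⬝ᵥ unitVec N (i + 2) + v ⬝ᵥ unitVec N i := by
      simp only [Matrix.mulVec, dotProduct, incidence, Matrix.of_apply, unitVec]
      rw [← sum_add_distrib]
      refine sum_congr rfl fun j _ => ?_
      simp only [show ((i : ℕ) + 1 = j) ↔ ((j : ℕ) + 1 = i + 2) by omega,
        show ((i : ℕ) = j + 1) ↔ ((j : ℕ) + 1 = i) by omega]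
      ring
    rw [e, dotProduct_unitVec, dotProduct_unitVec]
    have hi := i.2
    have a1 : pathExt v 0 (i : ℕ) = pathExt v c i := by
      unfold pathExt
      by_cases h0 : (i : ℕ) = 0
      · simp [h0]
      · rw [if_neg h0, if_neg h0, dif_pos (by omega), dif_pos (by omega)]
    have a2 : pathExt v 0 ((i : ℕ) + 2) =
        pathExt v c (i + 2) - c * unitVec N (N - 1) i := by
      unfold pathExt unitVec
      by_cases h0 : (i : ℕ) + 1 = N - 1
      · rw [if_neg (by omega), if_neg (by omega), dif_neg (by omega), dif_neg (by omega),
          if_pos h0]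
        ring
      · rw [if_neg (by omega), if_neg (by omega), dif_pos (by omega), dif_pos (by omega),
          if_neg h0]
        ring
    rw [a1, a2]; ring
  rw [cartan, Matrix.sub_mulVec, Matrix.smul_mulVec, Matrix.one_mulVec, Pi.sub_apply, h1,
    Pi.smul_apply, pathExt_fin, smul_eq_mul]
  ring

/-- Vanishing second differences make the extension by zero linear in the position, and it is zero
at both ends. -/
theorem cartan_mulVec_eq_zero {v : Fin (N - 1) → ℚ} (h : cartan N *ᵥ v = 0) : v = 0 := by
  have hY : ∀ i < N - 1, 2 * pathExt v 0 (i + 1) = pathExt v 0 i + pathExt v 0 (i + 2) := by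
    intro i hi
    have h1 := cartan_mulVec_apply v 0 ⟨i, hi⟩
    rw [h] at h1
    simp only [Pi.zero_apply] at h1
    linarith
  have hlin : ∀ j ≤ N - 1 + 1, pathExt v 0 j = j * pathExt v 0 1 := by
    intro j
    induction j using Nat.strong_induction_on with
    | _ j ih =>
      intro hj
      match j with
      | 0 => simp
      | 1 => simp
      | j + 2 =>
        have h1 := hY j (by omega)
        have h2 := ih j (by omega) (by omega)
        have h3 := ih (j + 1) (by omega) (by omega)
        push_cast at *
        linear_combination (-1 : ℚ) * h1 - h2 + 2 * h3
  have h1 : pathExt v 0 1 = 0 := by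
    have h2 := hlin (N - 1 + 1) le_rfl
    rw [pathExt_last] at h2
    exact (mul_eq_zero.mp h2.symm).resolve_left (by positivity)
  funext i
  have h2 := hlin (i + 1) (by omega)
  rwa [pathExt_fin, h1, mul_zero] at h2

theorem isUnit_det_cartan (N : ℕ) : IsUnit (cartan N).det := by
  rw [isUnit_iff_ne_zero]
  intro h
  obtain ⟨v, hv, h1⟩ := Matrix.exists_mulVec_eq_zero_iff.mpr h
  exact hv (cartan_mulVec_eq_zero h1)

theorem cartan_mulVec_inv (v : Fin (N - 1) → ℚ) : cartan N *ᵥ ((cartan N)⁻¹ *ᵥ v) = v := by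
  rw [Matrix.mulVec_mulVec, Matrix.mul_nonsing_inv _ (isUnit_det_cartan N), Matrix.one_mulVec]

theorem cartan_inv_mulVec (v : Fin (N - 1) → ℚ) : (cartan N)⁻¹ *ᵥ (cartan N *ᵥ v) = v := by
  rw [Matrix.mulVec_mulVec, Matrix.nonsing_inv_mul _ (isUnit_det_cartan N), Matrix.one_mulVec]

theorem cartan_transpose (N : ℕ) : (cartan N)ᵀ = cartan N := by
  ext i j
  simp only [cartan, incidence, Matrix.transpose_apply, Matrix.sub_apply, Matrix.smul_apply,
    Matrix.of_apply, Matrix.one_apply, eq_comm (a := j) (b := i)]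
  simp only [show ((j : ℕ) + 1 = i) ↔ ((i : ℕ) = j + 1) by omega,
    show ((j : ℕ) = i + 1) ↔ ((i : ℕ) + 1 = j) by omega]
  ring

/-- The extension by zero of `C⁻¹ η` to positions `0, …, N`. -/
noncomputable def heightPath (N : ℕ) (η : Fin (N - 1) → ℕ) : ℕ → ℚ :=
  pathExt ((cartan N)⁻¹ *ᵥ toRat η) 0

theorem heightPath_zero (η : Fin (N - 1) → ℕ) : heightPath N η 0 = 0 := pathExt_zero _ _

theorem heightPath_last (hN : 1 ≤ N) (η : Fin (N - 1) → ℕ) : heightPath N η N = 0 := by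
  have := pathExt_last ((cartan N)⁻¹ *ᵥ toRat η) 0
  rwa [Nat.sub_add_cancel hN] at this

theorem heightPath_diff (η : Fin (N - 1) → ℕ) (i : Fin (N - 1)) :
    (η i : ℚ) = 2 * heightPath N η (i + 1) - heightPath N η i - heightPath N η (i + 2) := by
  have h := cartan_mulVec_apply ((cartan N)⁻¹ *ᵥ toRat η) 0 i
  rw [cartan_mulVec_inv, zero_mul, add_zero] at h
  exact h

theorem sum_by_parts (Y : ℕ → ℚ) (d : ℕ) :
    ∑ i ∈ range d, (2 * Y (i + 1) - Y i - Y (i + 2)) * Y (i + 1) =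
      ∑ i ∈ range (d + 1), (Y (i + 1) - Y i) ^ 2 - Y (d + 1) * (Y (d + 1) - Y d) +
        Y 0 * (Y 1 - Y 0) := by
  induction d with
  | zero => simp; ring
  | succ d ih => rw [sum_range_succ, ih, sum_range_succ _ (d + 1)]; ring

/-- Summation by parts turns `η C⁻¹ η` into the Dirichlet energy of `C⁻¹η`; symmetry of `C⁻¹` gives
the linear term. -/
theorem quadExp_eq (hN : 1 ≤ N) (l : ℕ) (η : Fin (N - 1) → ℕ) :
    quadExp N l η = ∑ i ∈ range N, (heightPath N η (i + 1) - heightPath N η i) ^ 2 -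
      heightPath N η l := by
  have hsym : ((cartan N)⁻¹)ᵀ = (cartan N)⁻¹ := by
    rw [Matrix.transpose_nonsing_inv, cartan_transpose]
  have h1 : toRat η ⬝ᵥ ((cartan N)⁻¹ *ᵥ unitVec N l) = heightPath N η l := by
    rw [Matrix.dotProduct_mulVec, ← Matrix.mulVec_transpose, hsym, dotProduct_unitVec]
    rfl
  have h2 : toRat η ⬝ᵥ ((cartan N)⁻¹ *ᵥ toRat η) =
      ∑ i ∈ range (N - 1), (2 * heightPath N η (i + 1) - heightPath N η i -
        heightPath N η (i + 2)) * heightPath N η (i + 1) := by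
    rw [← Fin.sum_univ_eq_sum_range (fun i => (2 * heightPath N η (i + 1) - heightPath N η i -
        heightPath N η (i + 2)) * heightPath N η (i + 1))]
    refine sum_congr rfl fun i _ => ?_
    rw [← heightPath_diff]
    congr 1
    exact (pathExt_fin _ _ i).symm
  rw [quadExp, Matrix.mulVec_sub, dotProduct_sub, h1, h2, sum_by_parts, Nat.sub_add_cancel hN,
    heightPath_zero, heightPath_last hN]
  ring

theorem sum_sq_le (hN : 1 ≤ N) (η : Fin (N - 1) → ℕ) :
    ∑ i, (η i : ℚ) ^ 2 ≤ 4 * ∑ i ∈ range N, (heightPath N η (i + 1) - heightPath N η i) ^ 2 := by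
  set Y := heightPath N η with hY
  have h1 : ∑ i, (η i : ℚ) ^ 2 ≤ ∑ i ∈ range (N - 1),
      (2 * (Y (i + 1) - Y i) ^ 2 + 2 * (Y (i + 1 + 1) - Y (i + 1)) ^ 2) := by
    rw [← Fin.sum_univ_eq_sum_range
      (fun i => 2 * (Y (i + 1) - Y i) ^ 2 + 2 * (Y (i + 1 + 1) - Y (i + 1)) ^ 2)]
    refine sum_le_sum fun i _ => ?_
    rw [heightPath_diff, ← hY]
    nlinarith [sq_nonneg (Y (i + 2) - Y i)]
  refine h1.trans ?_
  rw [sum_add_distrib, ← mul_sum, ← mul_sum]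
  have h2 : ∑ i ∈ range N, (Y (i + 1) - Y i) ^ 2 =
      ∑ i ∈ range (N - 1), (Y (i + 1) - Y i) ^ 2 + (Y N - Y (N - 1)) ^ 2 := by
    conv_lhs => rw [← Nat.sub_add_cancel hN, sum_range_succ, Nat.sub_add_cancel hN]
  have h3 : ∑ i ∈ range N, (Y (i + 1) - Y i) ^ 2 =
      ∑ i ∈ range (N - 1), (Y (i + 1 + 1) - Y (i + 1)) ^ 2 + (Y 1 - Y 0) ^ 2 := by
    conv_lhs => rw [← Nat.sub_add_cancel hN, sum_range_succ']
  nlinarith [sq_nonneg (Y N - Y (N - 1)), sq_nonneg (Y 1 - Y 0)]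

/-- With `D` the energy and `Y = C⁻¹η`, Cauchy–Schwarz gives `Y_ℓ² ≤ N D`, hence `Y_ℓ ≤ D/2 + N/2`.
Since `D ≥ ∑ η_i² / 4` and `η_i² ≥ η_i`, the exponent grows at least linearly, enough for geometric
domination. -/
theorem quadExp_lower (hN : 1 ≤ N) {l : ℕ} (hl : l ≤ N) (η : Fin (N - 1) → ℕ) :
    ∑ i, (η i : ℚ) / 8 - N / 2 ≤ quadExp N l η := by
  rw [quadExp_eq hN]
  have h1 := sum_sq_le hN η
  set Y := heightPath N η with hY
  set D := ∑ i ∈ range N, (Y (i + 1) - Y i) ^ 2 with hD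
  have h2 : ∑ i, (η i : ℚ) / 8 ≤ ∑ i, (η i : ℚ) ^ 2 / 8 := by
    refine sum_le_sum fun i _ => ?_
    have : (η i : ℚ) ≤ (η i : ℚ) ^ 2 := by exact_mod_cast Nat.le_self_pow two_ne_zero _
    linarith
  rw [← sum_div] at h2
  rw [← sum_div] at h2 ⊢
  have h3 : Y l = ∑ i ∈ range l, (Y (i + 1) - Y i) := by
    rw [sum_range_sub, hY, heightPath_zero, sub_zero]
  have h4 : Y l ^ 2 ≤ N * D := by
    rw [h3]
    calc (∑ i ∈ range l, (Y (i + 1) - Y i)) ^ 2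
        ≤ (range l).card * ∑ i ∈ range l, (Y (i + 1) - Y i) ^ 2 := sq_sum_le_card_mul_sum_sq
      _ ≤ N * D := by
          rw [card_range]
          have : ∑ i ∈ range l, (Y (i + 1) - Y i) ^ 2 ≤ D :=
            sum_le_sum_of_subset_of_nonneg (range_mono hl) fun _ _ _ => sq_nonneg _
          have h0 : (0 : ℚ) ≤ ∑ i ∈ range l, (Y (i + 1) - Y i) ^ 2 :=
            sum_nonneg fun _ _ => sq_nonneg _
          have : (l : ℚ) ≤ N := by exact_mod_cast hl
          gcongr
  have hNpos : (0 : ℚ) < N := by exact_mod_cast hN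
  have h5 : Y l ≤ D / 2 + N / 2 := by
    have : (N : ℚ) * (Y l) ≤ N * (D / 2 + N / 2) := by nlinarith [sq_nonneg (Y l - N)]
    exact le_of_mul_le_mul_left this hNpos
  linarith

end Cartan

/-! ### Vectors `η` and convex integer paths -/

section PathBijection

variable {N L : ℕ}

/-- The path `j L / N - (C⁻¹ η)_j`. -/
noncomputable def ratPath (N L : ℕ) (η : Fin (N - 1) → ℕ) (j : ℕ) : ℚ :=
  (j : ℚ) * L / N - heightPath N η j

/-- The interior vertices of the path attached to `η`, rounded to integers. -/
noncomputable def intPath (N L : ℕ) (η : Fin (N - 1) → ℕ) (i : Fin (N - 1)) : ℤ :=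
  ⌊ratPath N L η (i + 1)⌋

theorem ratPath_zero (η : Fin (N - 1) → ℕ) : ratPath N L η 0 = 0 := by
  simp [ratPath, heightPath_zero]

theorem ratPath_last (hN : 1 ≤ N) (η : Fin (N - 1) → ℕ) : ratPath N L η N = L := by
  have : (N : ℚ) ≠ 0 := by positivity
  rw [ratPath, heightPath_last hN]
  field_simp
  ring

theorem ratPath_diff (η : Fin (N - 1) → ℕ) (i : Fin (N - 1)) :
    (η i : ℚ) = ratPath N L η i - 2 * ratPath N L η (i + 1) + ratPath N L η (i + 2) := by
  rw [heightPath_diff]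
  simp only [ratPath]
  push_cast
  ring

theorem congr_iff (η : Fin (N - 1) → ℕ) :
    Congr N L η ↔ ∃ z : ℤ, ratPath N L η 1 = z := by
  rw [Congr, dotProduct_comm, dotProduct_unitVec]
  simp [ratPath, heightPath]

/-- The congruence makes vertex 1 integral, vertex 0 is 0 and the second differences are the
integers `η_i`, so every vertex is integral and the floor loses nothing. -/
theorem pathExt_intPath (hN : 1 ≤ N) {η : Fin (N - 1) → ℕ} (h : Congr N L η) {j : ℕ}
    (hj : j ≤ N) : ((pathExt (intPath N L η) (L : ℤ) j : ℤ) : ℚ) = ratPath N L η j := by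
  have hint : ∀ j ≤ N, ∃ z : ℤ, ratPath N L η j = z := by
    intro j
    induction j using Nat.strong_induction_on with
    | _ j ih =>
      intro hj
      match j with
      | 0 => exact ⟨0, by simp [ratPath_zero]⟩
      | 1 => exact (congr_iff η).mp h
      | j + 2 =>
        obtain ⟨a, ha⟩ := ih j (by omega) (by omega)
        obtain ⟨b, hb⟩ := ih (j + 1) (by omega) (by omega)
        have := ratPath_diff (L := L) η ⟨j, by omega⟩
        refine ⟨η ⟨j, by omega⟩ - a + 2 * b, ?_⟩
        push_cast
        rw [this, ← ha, ← hb]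
        ring
  rcases Nat.eq_zero_or_pos j with rfl | h0
  · simp [ratPath_zero]
  rcases hj.lt_or_eq with hlt | rfl
  · obtain ⟨i, rfl⟩ : ∃ i : Fin (N - 1), j = i + 1 := ⟨⟨j - 1, by omega⟩, by simp; omega⟩
    obtain ⟨z, hz⟩ := hint _ hj
    rw [pathExt_fin, intPath, hz, Int.floor_intCast]
  · have := pathExt_last (intPath j L η) (L : ℤ)
    rw [Nat.sub_add_cancel hN] at this
    rw [this, ratPath_last hN]
    simp

theorem intPath_diff (hN : 1 ≤ N) {η : Fin (N - 1) → ℕ} (h : Congr N L η) (i : Fin (N - 1)) :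
    (η i : ℤ) = pathExt (intPath N L η) (L : ℤ) i - 2 * pathExt (intPath N L η) (L : ℤ) (i + 1) +
      pathExt (intPath N L η) (L : ℤ) (i + 2) := by
  have h1 := ratPath_diff (L := L) η i
  have hi := i.2
  rw [← pathExt_intPath hN h (by omega), ← pathExt_intPath hN h (by omega),
    ← pathExt_intPath hN h (by omega)] at h1
  exact_mod_cast h1

theorem intPath_injOn (hN : 1 ≤ N) {η η' : Fin (N - 1) → ℕ} (h : Congr N L η)
    (h' : Congr N L η') (he : intPath N L η = intPath N L η') : η = η' := by
  funext i
  have h1 := intPath_diff hN h i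
  rw [he, ← intPath_diff hN h' i] at h1
  exact_mod_cast h1

theorem exists_intPath_eq (hN : 1 ≤ N) (v : Fin (N - 1) → ℤ)
    (hv : ∀ i < N - 1, 2 * pathExt v (L : ℤ) (i + 1) ≤ pathExt v (L : ℤ) i +
      pathExt v (L : ℤ) (i + 2)) :
    ∃ η, Congr N L η ∧ intPath N L η = v := by
  set K := pathExt v (L : ℤ) with hK
  have hN0 : (N : ℚ) ≠ 0 := by positivity
  have hKN : K N = L := by
    have := pathExt_last v (L : ℤ)
    rwa [Nat.sub_add_cancel hN] at this
  let η : Fin (N - 1) → ℕ := fun i => (K i - 2 * K (i + 1) + K (i + 2)).toNat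
  -- The intended value of `C⁻¹η`, read off from `K_j = jL/N - (C⁻¹η)_j`.
  let w : Fin (N - 1) → ℚ := fun i => ((i + 1 : ℕ) : ℚ) * L / N - v i
  have hw : ∀ j ≤ N, pathExt w 0 j = (j : ℚ) * L / N - K j := by
    intro j hj
    rcases Nat.eq_zero_or_pos j with rfl | h0
    · simp [hK]
    rcases hj.lt_or_eq with hlt | rfl
    · obtain ⟨i, rfl⟩ : ∃ i : Fin (N - 1), j = i + 1 := ⟨⟨j - 1, by omega⟩, by simp; omega⟩
      rw [pathExt_fin, hK, pathExt_fin]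
    · have := pathExt_last w 0
      rw [Nat.sub_add_cancel hN] at this
      rw [this, hKN]
      push_cast
      field_simp
      ring
  have hη : cartan N *ᵥ w = toRat η := by
    funext i
    have hi := i.2
    rw [cartan_mulVec_apply w 0 i, hw _ (by omega), hw _ (by omega), hw _ (by omega)]
    have h1 : ((η i : ℤ) : ℚ) = ((K i - 2 * K (i + 1) + K (i + 2) : ℤ) : ℚ) := by
      congr 1
      exact Int.toNat_of_nonneg (by have := hv i i.2; omega)
    have h2 : toRat η i = ((η i : ℤ) : ℚ) := by simp [toRat]
    rw [h2, h1]
    push_cast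
    ring
  have hr : ∀ j ≤ N, ratPath N L η j = K j := by
    intro j hj
    rw [ratPath, heightPath, ← hη, cartan_inv_mulVec, hw j hj]
    ring
  refine ⟨η, (congr_iff η).mpr ⟨K 1, hr 1 hN⟩, ?_⟩
  funext i
  have hi := i.2
  rw [intPath, hr _ (by omega), Int.floor_intCast, hK, pathExt_fin]

end PathBijection

/-! ### The exponent in terms of the path -/

section Exponent

variable {N L : ℕ}

/-- The sequence `min j ℓ`. -/
def capped (l j : ℕ) : ℤ := min (j : ℤ) l

theorem capped_zero (l : ℕ) : capped l 0 = 0 := by simp [capped]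

theorem capped_eq_right {l j : ℕ} (h : l ≤ j) : capped l j = l := by
  unfold capped; omega

/-- This is the concavity required of `lam` in the recurrence, which is applied with `lam j = min(j,
ℓ)`. -/
theorem capped_concave (l j : ℕ) :
    capped l j + capped l (j + 2) ≤ 2 * capped l (j + 1) := by
  unfold capped; omega

theorem capped_diff (l j : ℕ) :
    capped l (j + 1) - capped l j = if j < l then 1 else 0 := by
  unfold capped; split_ifs <;> omega

theorem capped_diff_two (l j : ℕ) :
    2 * capped l (j + 1) - capped l j - capped l (j + 2) = if j + 1 = l then 1 else 0 := by
  unfold capped; split_ifs <;> omega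

theorem sum_stepExp_capped {l d : ℕ} (hl : l ≤ d) (K : ℕ → ℤ) (h0 : K 0 = 0) :
    ∑ i ∈ range d, stepExp (capped l) i (K (i + 1) - K i) =
      ∑ i ∈ range d, (K (i + 1) - K i) ^ 2 + K l := by
  simp only [stepExp, capped_diff, sum_add_distrib, ite_mul, one_mul, zero_mul]
  congr 1
  rw [← sum_filter, show (range d).filter (· < l) = range l by ext; simp; omega, sum_range_sub, h0,
    sub_zero]

/-- In the energy of `jL/N - K_j` the cross terms telescope to `-2L²/N`, and all fractional parts
cancel against `L(L + ℓ)/N`. Only integer powers of `q` remain. -/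
theorem outerExp_add_quadExp (hN : 1 ≤ N) {l : ℕ} (hl : l ≤ N) {η : Fin (N - 1) → ℕ}
    (h : Congr N L η) :
    outerExp N l L + quadExp N l η = ((∑ i ∈ range N, stepExp (capped l) i
      (pathExt (intPath N L η) (L : ℤ) (i + 1) - pathExt (intPath N L η) (L : ℤ) i) : ℤ) : ℚ) := by
  have hN0 : (N : ℚ) ≠ 0 := by positivity
  rw [sum_stepExp_capped hl _ (pathExt_zero _ _), quadExp_eq hN]
  have hpath : ∀ j ≤ N, heightPath N η j =
      (j : ℚ) * L / N - pathExt (intPath N L η) (L : ℤ) j := by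
    intro j hj
    rw [pathExt_intPath hN h hj, ratPath]
    ring
  have h0 := pathExt_zero (intPath N L η) (L : ℤ)
  have hlast : pathExt (intPath N L η) (L : ℤ) N = L := by
    have := pathExt_last (intPath N L η) (L : ℤ)
    rwa [Nat.sub_add_cancel hN] at this
  set K := pathExt (intPath N L η) (L : ℤ)
  have h1 : ∑ i ∈ range N, (heightPath N η (i + 1) - heightPath N η i) ^ 2 =
      ∑ i ∈ range N, (((K (i + 1) : ℚ) - K i) ^ 2 + ((L : ℚ) / N) ^ 2 -
        2 * L / N * ((K (i + 1) : ℚ) - K i)) := by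
    refine sum_congr rfl fun i hi => ?_
    have := mem_range.mp hi
    rw [hpath _ (by omega), hpath _ (by omega)]
    push_cast
    ring
  rw [h1, hpath l hl, sum_sub_distrib, sum_add_distrib, ← mul_sum,
    sum_range_sub (fun i => (K i : ℚ)), h0, hlast, sum_const, card_range, nsmul_eq_mul, outerExp]
  push_cast
  field_simp
  ring

end Exponent

/-! ### Rational powers of `q` -/

section Power

variable {q : ℂ}

theorem qpow_add (hq0 : q ≠ 0) (a b : ℚ) : qpow q (a + b) = qpow q a * qpow q b := by
  simp only [qpow]
  rw [Rat.cast_add, Complex.cpow_add _ _ hq0]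

theorem qpow_intCast (q : ℂ) (z : ℤ) : qpow q (z : ℚ) = q ^ z := by
  simp [qpow]

theorem norm_qpow (q : ℂ) (r : ℚ) : ‖qpow q r‖ = ‖q‖ ^ (r : ℝ) := by
  rw [qpow, ← Complex.norm_cpow_real]
  simp

end Power

/-! ### Path sums as sums over `η`, and the fermionic polynomial at `n = 0` -/

section FermionicSum

variable {q : ℂ} {N L l : ℕ}

/-- The product of Gaussian polynomials along the path attached to `η`, shifted by `n / 2`. -/
noncomputable def gaussProd (q : ℂ) (N l L : ℕ) (n : ℤ) (η : Fin (N - 1) → ℕ) : ℂ :=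
  ∏ i : Fin (N - 1),
    gaussInt q (n + (2 * intPath N L η i + capped l (i + 1) + η i))
      (n + (2 * intPath N L η i + capped l (i + 1)))

theorem closedSum_eq_tsum_congr (hq0 : q ≠ 0) (hN : 1 ≤ N) (hl : l ≤ N) (n : ℤ) :
    closedSum q (capped l) (N - 1) n L = ∑' η : {η : Fin (N - 1) → ℕ // Congr N L η},
      qpow q (outerExp N l L + quadExp N l η.1) * gaussProd q N l L n η.1 := by
  rw [closedSum_eq_tsum]
  have hinj : Function.Injective
      fun η : {η : Fin (N - 1) → ℕ // Congr N L η} => intPath N L η.1 :=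
    fun η η' h => Subtype.ext (intPath_injOn hN η.2 η'.2 h)
  rw [← hinj.tsum_eq]
  · refine tsum_congr fun ⟨η, hη⟩ => ?_
    have h1 := closedSum_term_eq hq0 (capped l) n (N - 1) (pathExt (intPath N L η) (L : ℤ))
    rw [pathExt_last] at h1
    simp only
    rw [h1, outerExp_add_quadExp hN hl hη, qpow_intCast, Nat.sub_add_cancel hN]
    congr 1
    refine prod_congr rfl fun i _ => ?_
    have h2 := intPath_diff hN hη i
    have h3 := pathExt_fin (intPath N L η) (L : ℤ) i
    rw [← h3]
    congr 1 <;> linarith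
  · intro v hv
    have hv := prod_ne_zero_iff.mp (right_ne_zero_of_mul hv)
    obtain ⟨η, h1, h2⟩ := exists_intPath_eq (L := L) hN v (fun i hi => by
      have h2 := le_of_gaussInt_ne_zero (right_ne_zero_of_mul (hv i (mem_range.mpr hi)))
      linarith [h2.2])
    exact ⟨⟨η, h1⟩, h2⟩

/-- The system reads `C m = (2L + ℓ) e_{N-1} + e_ℓ - 2η`. The vector `2K + min(j, ℓ)` solves it, as
`η` is the second difference of `K` and `e_ℓ` is minus that of `min(j, ℓ)`; `C` is invertible. -/
theorem mem_mnPairs_iff (hN : 1 ≤ N) (hl : l ≤ N) (p : (Fin (N - 1) → ℕ) × (Fin (N - 1) → ℕ)) :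
    p ∈ mnPairs N l L ↔ Congr N L p.2 ∧
      ∀ i, (p.1 i : ℤ) = 2 * intPath N L p.2 i + capped l (i + 1) := by
  obtain ⟨m, η⟩ := p
  refine and_congr_right fun h => ?_
  dsimp only at h ⊢
  set K := pathExt (intPath N L η) (L : ℤ) with hK
  let u : Fin (N - 1) → ℚ := fun i => ((2 * intPath N L η i + capped l (i + 1) : ℤ) : ℚ)
  have hu : ∀ j ≤ N, pathExt u (2 * (L : ℚ) + l) j = ((2 * K j + capped l j : ℤ) : ℚ) := by
    intro j hj
    rcases Nat.eq_zero_or_pos j with rfl | h0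
    · simp [hK, capped_zero]
    rcases hj.lt_or_eq with hlt | rfl
    · obtain ⟨i, rfl⟩ : ∃ i : Fin (N - 1), j = i + 1 := ⟨⟨j - 1, by omega⟩, by simp; omega⟩
      rw [pathExt_fin, hK, pathExt_fin]
    · have h1 := pathExt_last u (2 * (L : ℚ) + l)
      have h2 := pathExt_last (intPath j L η) (L : ℤ)
      rw [Nat.sub_add_cancel hN] at h1 h2
      rw [h1, hK, h2, capped_eq_right hl]
      push_cast
      ring
  have hCu : cartan N *ᵥ u = (2 * (L : ℚ) + l) • unitVec N (N - 1) + unitVec N l -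
      (2 : ℚ) • toRat η := by
    funext i
    have hi := i.2
    rw [cartan_mulVec_apply u (2 * (L : ℚ) + l) i, hu _ (by omega), hu _ (by omega),
      hu _ (by omega)]
    have h1 : unitVec N l i =
        ((2 * capped l (i + 1) - capped l i - capped l (i + 2) : ℤ) : ℚ) := by
      rw [capped_diff_two, unitVec]
      push_cast
      rfl
    have h2 : toRat η i = ((K i - 2 * K (i + 1) + K (i + 2) : ℤ) : ℚ) := by
      rw [hK, ← intPath_diff hN h i]
      simp [toRat]
    simp only [Pi.sub_apply, Pi.add_apply, Pi.smul_apply, smul_eq_mul]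
    rw [h1, h2]
    push_cast
    ring
  have hCm : MNSystem N l L m η ↔ cartan N *ᵥ toRat m = cartan N *ᵥ u := by
    rw [hCu, MNSystem, cartan, Matrix.sub_mulVec, Matrix.smul_mulVec, Matrix.one_mulVec,
      funext_iff, funext_iff]
    refine forall_congr' fun i => ?_
    simp only [Pi.sub_apply, Pi.add_apply, Pi.smul_apply, smul_eq_mul]
    constructor <;> intro h' <;> linarith
  rw [hCm]
  constructor
  · intro h' i
    have h1 : toRat m = u := by
      rw [← cartan_inv_mulVec (toRat m), h', cartan_inv_mulVec]
    have h2 := congrFun h1 i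
    have h3 : ((m i : ℤ) : ℚ) = ((2 * intPath N L η i + capped l (i + 1) : ℤ) : ℚ) := by
      rw [Int.cast_natCast]
      exact h2
    exact_mod_cast h3
  · intro h'
    congr 1
    funext i
    show ((m i : ℕ) : ℚ) = ((2 * intPath N L η i + capped l (i + 1) : ℤ) : ℚ)
    rw [← h' i, Int.cast_natCast]

/-- Nonnegativity of `m` bounds the path below, convexity bounds it above by `L`, and the path
determines the pair. -/
theorem finite_mnPairs (hN : 1 ≤ N) (hl : l ≤ N) (L : ℕ) : (mnPairs N l L).Finite := by
  refine Set.Finite.of_injOn (f := fun p => intPath N L p.2)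
    (t := Set.Icc (fun _ => -(l : ℤ)) (fun _ => (L : ℤ))) ?_ ?_ (Set.finite_Icc _ _)
  · intro p hp
    obtain ⟨h1, h2⟩ := (mem_mnPairs_iff hN hl p).mp hp
    refine Set.mem_Icc.mpr ⟨fun i => ?_, fun i => ?_⟩
    · have h3 := h2 i
      have : capped l (i + 1) ≤ l := min_le_right _ _
      show -(l : ℤ) ≤ intPath N L p.2 i
      omega
    · have h3 := convex_path_le (d := N - 1) (pathExt_zero (intPath N L p.2) (L : ℤ))
        (fun j hj => by have := intPath_diff hN h1 ⟨j, hj⟩; simp only at this; omega)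
        (j := i + 1) (by omega)
      rw [pathExt_fin, pathExt_last] at h3
      exact h3.trans (max_le (by positivity) le_rfl)
  · intro p hp p' hp' he
    obtain ⟨h1, h2⟩ := (mem_mnPairs_iff hN hl p).mp hp
    obtain ⟨h1', h2'⟩ := (mem_mnPairs_iff hN hl p').mp hp'
    dsimp only at he
    refine Prod.ext (funext fun i => ?_) (intPath_injOn hN h1 h1' he)
    have h3 := h2 i
    rw [he, ← h2' i] at h3
    exact_mod_cast h3

theorem qpow_mul_fermionicPoly (hq0 : q ≠ 0) (hN : 1 ≤ N) (hl : l ≤ N) (L : ℕ) :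
    qpow q (outerExp N l L) * fermionicPoly q N l L = closedSum q (capped l) (N - 1) 0 L := by
  rw [closedSum_eq_tsum_congr hq0 hN hl]
  have hfin := finite_mnPairs hN hl L
  rw [fermionicPoly, finsum_mem_eq_finite_toFinset_sum _ hfin, ← Finset.tsum_subtype,
    ← tsum_mul_left]
  let g : {p // p ∈ hfin.toFinset} → {η : Fin (N - 1) → ℕ // Congr N L η} :=
    fun p => ⟨p.1.2, ((mem_mnPairs_iff hN hl p.1).mp (hfin.mem_toFinset.mp p.2)).1⟩
  have hmem := fun p : {p // p ∈ hfin.toFinset} =>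
    ((mem_mnPairs_iff hN hl p.1).mp (hfin.mem_toFinset.mp p.2)).2
  have hg : Function.Injective g := by
    intro p p' h
    have h1 : p.1.2 = p'.1.2 := congrArg Subtype.val h
    refine Subtype.ext (Prod.ext (funext fun i => ?_) h1)
    have h2 := hmem p i
    rw [h1, ← hmem p' i] at h2
    exact_mod_cast h2
  rw [← hg.tsum_eq]
  · refine tsum_congr fun p => ?_
    rw [qpow_add hq0, mul_assoc]
    congr 2
    refine prod_congr rfl fun i _ => ?_
    show _ = gaussInt q (0 + (2 * intPath N L p.1.2 i + capped l (i + 1) + p.1.2 i))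
      (0 + (2 * intPath N L p.1.2 i + capped l (i + 1)))
    rw [← hmem p i, zero_add, zero_add, ← gaussInt_natCast, gaussInt, gaussInt]
    -- The path weight has lower entry `m_i`, the fermionic sum `n_i`; the symmetry of the Gaussian
    -- polynomial identifies them.
    have h1 : (p.1.1 i + p.1.2 i - p.1.2 i : ℕ) = p.1.1 i := by omega
    have h2 : (p.1.1 i + p.1.2 i - p.1.1 i : ℕ) = p.1.2 i := by omega
    rw [if_pos (by omega), if_pos (by omega)]
    norm_cast
    simp only [gauss, h1, h2]
    rw [if_pos (by omega), if_pos (by omega), mul_comm (qPoch q q (p.1.1 i))]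
  · intro η hη
    have h1 := prod_ne_zero_iff.mp (right_ne_zero_of_mul hη)
    -- A negative would-be `m_i` kills the Gaussian factor, so nonzero terms come from admissible
    -- pairs.
    have h2 : ∀ i, 0 ≤ 2 * intPath N L η.1 i + capped l (i + 1) := fun i => by
      have := (le_of_gaussInt_ne_zero (h1 i (mem_univ i))).1
      omega
    refine ⟨⟨(fun i => (2 * intPath N L η.1 i + capped l (i + 1)).toNat, η.1),
      hfin.mem_toFinset.mpr ((mem_mnPairs_iff hN hl _).mpr ⟨η.2, fun i => ?_⟩)⟩, rfl⟩
    exact Int.toNat_of_nonneg (h2 i)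

end FermionicSum

/-! ### Uniform bounds and summability -/

section Bounds

variable {q : ℂ} {N l : ℕ}

theorem summable_pow_sum {r : ℝ} (h0 : 0 ≤ r) (h1 : r < 1) (d : ℕ) :
    Summable fun η : Fin d → ℕ => r ^ ∑ i, η i := by
  induction d with
  | zero => exact (hasSum_fintype _).summable
  | succ d ih =>
    let e : ℕ × (Fin d → ℕ) ≃ (Fin (d + 1) → ℕ) := Fin.consEquiv fun _ => ℕ
    rw [← e.summable_iff]
    refine ((summable_geometric_of_lt_one h0 h1).mul_of_nonneg ih (fun _ => pow_nonneg h0 _)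
      (fun _ => pow_nonneg h0 _)).congr fun p => ?_
    have : e p = Fin.cons p.1 p.2 := rfl
    rw [Function.comp, this, Fin.sum_univ_succ, pow_add]
    simp

theorem summable_norm_qpow_quadExp (hq0 : q ≠ 0) (hq1 : ‖q‖ < 1) (hN : 1 ≤ N) (hl : l ≤ N) :
    Summable fun η : Fin (N - 1) → ℕ => ‖qpow q (quadExp N l η)‖ := by
  have hpos : 0 < ‖q‖ := norm_pos_iff.mpr hq0
  have hr1 : ‖q‖ ^ (1 / 8 : ℝ) < 1 := Real.rpow_lt_one hpos.le hq1 (by norm_num)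
  refine Summable.of_nonneg_of_le (fun _ => norm_nonneg _) (fun η => ?_)
    ((summable_pow_sum (by positivity) hr1 (N - 1)).mul_left (‖q‖ ^ (-(N : ℝ) / 2)))
  rw [norm_qpow, ← Real.rpow_natCast, ← Real.rpow_mul hpos.le, ← Real.rpow_add hpos]
  refine Real.rpow_le_rpow_of_exponent_ge hpos hq1.le ?_
  have h := quadExp_lower hN hl η
  rw [← sum_div] at h
  have h' : (((∑ i, (η i : ℚ)) / 8 - N / 2 : ℚ) : ℝ) ≤ (quadExp N l η : ℝ) := Rat.cast_le.mpr h
  push_cast at h' ⊢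
  linarith

/-- The numerator grows by at least `i² ≥ i`. -/
theorem outerExp_add_le (hN : 1 ≤ N) (k i : ℕ) :
    outerExp N l k + (i : ℚ) / N ≤ outerExp N l (k + i) := by
  have hN0 : (0 : ℚ) < N := by exact_mod_cast hN
  rw [outerExp, outerExp, ← add_div]
  gcongr
  push_cast
  have h1 : (i : ℚ) ≤ (i : ℚ) ^ 2 := by exact_mod_cast Nat.le_self_pow two_ne_zero _
  have h2 : (0 : ℚ) ≤ (k : ℚ) * i := by positivity
  have h3 : (0 : ℚ) ≤ (i : ℚ) * l := by positivity
  nlinarith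

theorem norm_qpow_outerExp_add_le (hq0 : q ≠ 0) (hq1 : ‖q‖ < 1) (hN : 1 ≤ N) (k i : ℕ) :
    ‖qpow q (outerExp N l (k + i))‖ ≤
      ‖qpow q (outerExp N l k)‖ * (‖q‖ ^ (1 / N : ℝ)) ^ i := by
  have hpos : 0 < ‖q‖ := norm_pos_iff.mpr hq0
  rw [norm_qpow, norm_qpow, ← Real.rpow_natCast, ← Real.rpow_mul hpos.le, ← Real.rpow_add hpos]
  refine Real.rpow_le_rpow_of_exponent_ge hpos hq1.le ?_
  have h := outerExp_add_le (l := l) hN k i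
  have h' : ((outerExp N l k + (i : ℚ) / N : ℚ) : ℝ) ≤ (outerExp N l (k + i) : ℝ) :=
    Rat.cast_le.mpr h
  push_cast at h'
  rw [one_div_mul_eq_div]
  exact h'

theorem summable_etaTerm (hq0 : q ≠ 0) (hq1 : ‖q‖ < 1) (hN : 1 ≤ N) (hl : l ≤ N) :
    Summable fun η : Fin (N - 1) → ℕ => ‖etaTerm q N l η‖ := by
  obtain ⟨B, hB1, hB⟩ := qPoch_self_bounds hq1
  refine Summable.of_nonneg_of_le (fun _ => norm_nonneg _) (fun η => ?_)
    ((summable_norm_qpow_quadExp hq0 hq1 hN hl).mul_right (B ^ (N - 1)))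
  rw [etaTerm, div_eq_mul_inv, norm_mul, ← prod_inv_distrib, norm_prod]
  gcongr
  calc ∏ i, ‖(qPoch q q (η i))⁻¹‖ ≤ ∏ _i : Fin (N - 1), B :=
        prod_le_prod (fun _ _ => norm_nonneg _) fun i _ => (hB _).2
    _ = B ^ (N - 1) := by simp

theorem norm_etaSum_le (hq0 : q ≠ 0) (hq1 : ‖q‖ < 1) (hN : 1 ≤ N) (hl : l ≤ N) (L : ℕ) :
    ‖etaSum q N l L‖ ≤ ∑' η : Fin (N - 1) → ℕ, ‖etaTerm q N l η‖ := by
  have h := summable_etaTerm hq0 hq1 hN hl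
  exact (norm_tsum_le_tsum_norm (h.subtype _)).trans
    (h.tsum_subtype_le _ _ fun _ => norm_nonneg _)

theorem norm_gaussProd_le (hq1 : ‖q‖ < 1) (N : ℕ) :
    ∃ B : ℝ, 0 ≤ B ∧ ∀ l L n η, ‖gaussProd q N l L n η‖ ≤ B := by
  obtain ⟨B, hB1, hB⟩ := norm_gaussInt_le hq1
  refine ⟨B ^ (N - 1), by positivity, fun l L n η => ?_⟩
  rw [gaussProd, norm_prod]
  calc ∏ i, ‖_‖ ≤ ∏ _i : Fin (N - 1), B :=
        prod_le_prod (fun _ _ => norm_nonneg _) fun i _ => hB _ _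
    _ = B ^ (N - 1) := by simp

theorem norm_closedSum_le (hq0 : q ≠ 0) (hq1 : ‖q‖ < 1) (hN : 1 ≤ N) (hl : l ≤ N) :
    ∃ M : ℝ, 0 ≤ M ∧ ∀ (n : ℤ) (L : ℕ),
      ‖closedSum q (capped l) (N - 1) n L‖ ≤ M * ‖qpow q (outerExp N l L)‖ := by
  obtain ⟨B, hB0, hB⟩ := norm_gaussProd_le hq1 N
  have hs := summable_norm_qpow_quadExp hq0 hq1 hN hl
  refine ⟨B * ∑' η : Fin (N - 1) → ℕ, ‖qpow q (quadExp N l η)‖,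
    mul_nonneg hB0 (tsum_nonneg fun _ => norm_nonneg _), fun n L => ?_⟩
  rw [closedSum_eq_tsum_congr hq0 hN hl]
  have hle : ∀ η : {η : Fin (N - 1) → ℕ // Congr N L η},
      ‖qpow q (outerExp N l L + quadExp N l η.1) * gaussProd q N l L n η.1‖ ≤
        ‖qpow q (outerExp N l L)‖ * B * ‖qpow q (quadExp N l η.1)‖ := fun η => by
    rw [qpow_add hq0, norm_mul, norm_mul, mul_right_comm]
    gcongr
    exact hB _ _ _ _
  have hs' := (hs.subtype {η | Congr N L η}).mul_left (‖qpow q (outerExp N l L)‖ * B)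
  have h1 := tsum_of_norm_bounded hs'.hasSum hle
  refine h1.trans ?_
  rw [tsum_mul_left]
  have h2 := hs.tsum_subtype_le _ {η | Congr N L η} fun _ => norm_nonneg _
  calc ‖qpow q (outerExp N l L)‖ * B * _ ≤ ‖qpow q (outerExp N l L)‖ * B *
        ∑' η : Fin (N - 1) → ℕ, ‖qpow q (quadExp N l η)‖ := by gcongr; exact h2
    _ = _ := by ring

end Bounds

/-! ### The limit `n → ∞` -/

section Limit

variable {q : ℂ} {N l : ℕ}

theorem tendsto_closedSum (hq0 : q ≠ 0) (hq1 : ‖q‖ < 1) (hN : 1 ≤ N) (hl : l ≤ N) (L : ℕ) :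
    Tendsto (fun n : ℕ => closedSum q (capped l) (N - 1) n L) atTop
      (𝓝 (qpow q (outerExp N l L) * etaSum q N l L)) := by
  obtain ⟨B, hB0, hB⟩ := norm_gaussProd_le hq1 N
  have hs := (summable_norm_qpow_quadExp hq0 hq1 hN hl).subtype {η | Congr N L η}
  simp_rw [closedSum_eq_tsum_congr hq0 hN hl]
  rw [etaSum, ← tsum_mul_left]
  refine tendsto_tsum_of_dominated_convergence
    (hs.mul_left (‖qpow q (outerExp N l L)‖ * B)) (fun η => ?_) (.of_forall fun n η => ?_)
  · have : qpow q (outerExp N l L) * etaTerm q N l η.1 =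
        qpow q (outerExp N l L + quadExp N l η.1) * ∏ i, (qPoch q q (η.1 i))⁻¹ := by
      rw [qpow_add hq0, etaTerm, prod_inv_distrib, div_eq_mul_inv, mul_assoc]
    rw [this]
    exact (tendsto_finsetProd _ fun i _ => tendsto_gaussInt hq1 _ _ _ rfl).const_mul _
  · rw [qpow_add hq0, norm_mul, norm_mul, mul_right_comm]
    simp only [Function.comp]
    gcongr
    exact hB _ _ _ _

theorem tendsto_connCoeff (hq1 : ‖q‖ < 1) (w i : ℕ) :
    Tendsto (fun n => connCoeff q n w i) atTop
      (𝓝 (qPochInf q q / (qPoch q q i * qPoch q q (i + w)))) := by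
  have hP := tendsto_qPoch hq1 q
  have hinf := qPochInf_self_ne_zero hq1
  have h1 : Tendsto (fun n => qPoch q q n / (qPoch q q i * qPoch q q (n - i)) *
      (qPoch q q (n + w) / qPoch q q (i + w))) atTop
      (𝓝 (qPochInf q q / (qPoch q q i * qPochInf q q) * (qPochInf q q / qPoch q q (i + w)))) :=
    (hP.div (tendsto_const_nhds.mul (hP.comp (tendsto_sub_atTop_nat i)))
      (mul_ne_zero (qPoch_self_ne_zero hq1 i) hinf)).mul
      ((hP.comp (tendsto_add_atTop_nat w)).div_const _)
  have e : qPochInf q q / (qPoch q q i * qPochInf q q) * (qPochInf q q / qPoch q q (i + w)) =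
      qPochInf q q / (qPoch q q i * qPoch q q (i + w)) := by
    have := qPoch_self_ne_zero hq1 i
    have := qPoch_self_ne_zero hq1 (i + w)
    field_simp
  rw [e] at h1
  refine h1.congr' ?_
  filter_upwards [eventually_ge_atTop i] with n hn
  rw [connCoeff, gauss, if_pos hn]

theorem norm_connCoeff_le (hq1 : ‖q‖ < 1) : ∃ B : ℝ, 0 ≤ B ∧ ∀ n w i, ‖connCoeff q n w i‖ ≤ B := by
  obtain ⟨B₁, h1, hB₁⟩ := norm_gauss_le hq1
  obtain ⟨B₂, h2, hB₂⟩ := qPoch_self_bounds hq1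
  refine ⟨B₁ * (B₂ * B₂), by positivity, fun n w i => ?_⟩
  rw [connCoeff, div_eq_mul_inv, norm_mul, norm_mul]
  gcongr
  · exact hB₁ _ _
  · exact (hB₂ _).1
  · exact (hB₂ _).2

/-- The conjugate Bailey pair identity. -/
theorem tsum_conjugate (hq0 : q ≠ 0) (hq1 : ‖q‖ < 1) (hN : 1 ≤ N) (hl : l ≤ N) (k : ℕ) :
    ∑' i : ℕ, closedSum q (capped l) (N - 1) 0 ((k + i : ℕ) : ℤ) *
        (qPochInf q q / (qPoch q q i * qPoch q q (i + (2 * k + l)))) =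
      qpow q (outerExp N l k) * etaSum q N l k := by
  obtain ⟨M, hM0, hM⟩ := norm_closedSum_le hq0 hq1 hN hl
  obtain ⟨B, hB0, hB⟩ := norm_connCoeff_le hq1
  have hpos : 0 < ‖q‖ := norm_pos_iff.mpr hq0
  have ht : ‖q‖ ^ (1 / N : ℝ) < 1 := Real.rpow_lt_one hpos.le hq1 (by positivity)
  -- Both sides are limits of `S(n, k)`: one through the finite expansion, the other through the sum
  -- over `η`.
  refine tendsto_nhds_unique ?_ (tendsto_closedSum hq0 hq1 hN hl k)
  have hfin : ∀ n : ℕ, closedSum q (capped l) (N - 1) n k =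
      ∑' i : ℕ, closedSum q (capped l) (N - 1) 0 ((k + i : ℕ) : ℤ) *
        connCoeff q n (2 * k + l) i := fun n => by
    rw [closedSum_eq_sum hq0 hq1 (capped_concave l) (capped_zero l) (N - 1) l
      (capped_eq_right (by omega)) n k]
    refine (tsum_eq_sum fun i hi => ?_).symm
    rw [connCoeff_of_lt q _ (by simpa using hi), mul_zero]
  simp_rw [hfin]
  refine tendsto_tsum_of_dominated_convergence
    (((summable_geometric_of_lt_one (by positivity) ht).mul_left
      (M * ‖qpow q (outerExp N l k)‖)).mul_right B)
    (fun i => (tendsto_connCoeff hq1 _ i).const_mul _) (.of_forall fun n i => ?_)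
  rw [norm_mul, mul_assoc M]
  gcongr
  · refine (hM _ _).trans ?_
    gcongr
    exact norm_qpow_outerExp_add_le hq0 hq1 hN k i
  · exact hB _ _ _

end Limit

/-! ### The Bailey pair and interchange of summation -/

section Interchange

theorem summable_sum_antidiagonal {f : ℕ × ℕ → ℂ} (hf : Summable f) :
    Summable fun n => ∑ p ∈ antidiagonal n, f p := by
  have h := (Finset.HasAntidiagonal.sigmaAntidiagonalEquivProd.summable_iff.mpr hf).sigma
  refine h.congr fun n => ?_
  rw [tsum_fintype]
  exact (Finset.sum_coe_sort (antidiagonal n) f)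

theorem tsum_sum_antidiagonal {f : ℕ × ℕ → ℂ} (hf : Summable f) :
    ∑' n, ∑ p ∈ antidiagonal n, f p = ∑' k, ∑' i, f (k, i) := by
  have h := Finset.HasAntidiagonal.sigmaAntidiagonalEquivProd.summable_iff.mpr hf
  simp only [Function.comp_def] at h
  rw [← hf.tsum_prod, ← Finset.HasAntidiagonal.sigmaAntidiagonalEquivProd.tsum_eq, h.tsum_sigma]
  refine tsum_congr fun n => ?_
  rw [tsum_fintype]
  exact (Finset.sum_coe_sort (antidiagonal n) f).symm

variable {q : ℂ} {N l : ℕ} {α β : ℕ → ℂ}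

/-- The double series obtained by inserting a Bailey pair into the conjugate pair identity. -/
noncomputable def baileyTerm (q : ℂ) (N l : ℕ) (α : ℕ → ℂ) (p : ℕ × ℕ) : ℂ :=
  α p.1 * closedSum q (capped l) (N - 1) 0 ((p.1 + p.2 : ℕ) : ℤ) *
    (qPoch q q l / (qPoch q q p.2 * qPoch q q (p.2 + (2 * p.1 + l))))

/-- The bound `S(0, k + i) = O(|q|^{k(k+ℓ)/N + i/N})` dominates the series by the product of the
assumed `α`-series and a geometric series. -/
theorem summable_baileyTerm (hq0 : q ≠ 0) (hq1 : ‖q‖ < 1) (hN : 1 ≤ N) (hl : l ≤ N)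
    (hα : Summable fun L : ℕ => qpow q (outerExp N l L) * α L) :
    Summable (baileyTerm q N l α) := by
  obtain ⟨M, hM0, hM⟩ := norm_closedSum_le hq0 hq1 hN hl
  obtain ⟨B, hB1, hB⟩ := qPoch_self_bounds hq1
  have hpos : 0 < ‖q‖ := norm_pos_iff.mpr hq0
  have ht : ‖q‖ ^ (1 / N : ℝ) < 1 := Real.rpow_lt_one hpos.le hq1 (by positivity)
  have hs := (hα.norm.mul_of_nonneg (summable_geometric_of_lt_one (by positivity) ht)
    (fun _ => norm_nonneg _) (fun _ => by positivity)).mul_left (M * (B * (B * B)))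
  refine Summable.of_norm_bounded hs fun p => ?_
  rw [baileyTerm, norm_mul, norm_mul]
  have h1 : ‖qPoch q q l / (qPoch q q p.2 * qPoch q q (p.2 + (2 * p.1 + l)))‖ ≤
      B * (B * B) := by
    rw [div_eq_mul_inv, mul_inv, norm_mul, norm_mul]
    gcongr
    · exact (hB _).1
    · exact (hB _).2
    · exact (hB _).2
  have h2 : ‖closedSum q (capped l) (N - 1) 0 ((p.1 + p.2 : ℕ) : ℤ)‖ ≤
      M * (‖qpow q (outerExp N l p.1)‖ * (‖q‖ ^ (1 / N : ℝ)) ^ p.2) := by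
    refine (hM _ _).trans ?_
    gcongr
    exact norm_qpow_outerExp_add_le hq0 hq1 hN _ _
  calc _ ≤ ‖α p.1‖ * (M * (‖qpow q (outerExp N l p.1)‖ * (‖q‖ ^ (1 / N : ℝ)) ^ p.2)) *
        (B * (B * B)) := by gcongr
    _ = _ := by rw [norm_mul]; ring

theorem tsum_baileyTerm (hq0 : q ≠ 0) (hq1 : ‖q‖ < 1) (hN : 1 ≤ N) (hl : l ≤ N) (k : ℕ) :
    ∑' i, baileyTerm q N l α (k, i) = 1 / qPochInf q (q ^ (l + 1)) *
      (qpow q (outerExp N l k) * α k * etaSum q N l k) := by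
  have h1 := qPochInf_self_eq hq1 l
  have h2 := qPochInf_self_ne_zero hq1
  have h3 := qPoch_self_ne_zero hq1 l
  have h4 : qPochInf q (q ^ (l + 1)) ≠ 0 := right_ne_zero_of_mul (h1 ▸ h2)
  have h5 : ∀ i, baileyTerm q N l α (k, i) = α k / qPochInf q (q ^ (l + 1)) *
      (closedSum q (capped l) (N - 1) 0 ((k + i : ℕ) : ℤ) *
        (qPochInf q q / (qPoch q q i * qPoch q q (i + (2 * k + l))))) := fun i => by
    rw [baileyTerm, h1]
    field_simp
  simp_rw [h5]
  rw [tsum_mul_left, tsum_conjugate hq0 hq1 hN hl]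
  ring

/-- On the diagonal `k + i = L` the factor `S(0, L)` is constant, and `(q)_{ℓ+L+k} = (q)_ℓ
(q^{ℓ+1})_{L+k}` turns the remaining sum into the definition of `β_L`. -/
theorem sum_antidiagonal_baileyTerm (hq0 : q ≠ 0) (hq1 : ‖q‖ < 1) (hN : 1 ≤ N) (hl : l ≤ N)
    (hαβ : IsBaileyPair q (q ^ l) α β) (L : ℕ) :
    ∑ p ∈ antidiagonal L, baileyTerm q N l α p =
      qpow q (outerExp N l L) * β L * fermionicPoly q N l L := by
  rw [mul_right_comm, qpow_mul_fermionicPoly hq0 hN hl, hαβ L, mul_sum,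
    Finset.Nat.sum_antidiagonal_eq_sum_range_succ_mk]
  refine sum_congr rfl fun k hk => ?_
  have hk' : k ≤ L := by simpa [Nat.lt_succ_iff] using hk
  have h1 := qPoch_self_add q l (L + k)
  have h2 := qPoch_self_ne_zero hq1 l
  have h3 : qPoch q (q ^ (l + 1)) (L + k) ≠ 0 :=
    right_ne_zero_of_mul (h1 ▸ qPoch_self_ne_zero hq1 _)
  have h4 := qPoch_self_ne_zero hq1 (L - k)
  rw [baileyTerm]
  dsimp only
  rw [Nat.add_sub_cancel' hk', show L - k + (2 * k + l) = l + (L + k) by omega, h1, ← pow_succ]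
  field_simp

end Interchange

end HigherBailey

theorem corollary1 (N ℓ : ℕ) (hN : 1 ≤ N) (hℓ : ℓ ≤ N)
    (q : ℂ) (hq0 : q ≠ 0) (hq1 : ‖q‖ < 1)
    (α β : ℕ → ℂ) (hαβ : HigherBailey.IsBaileyPair q (q ^ ℓ) α β)
    (hα : Summable fun L : ℕ => HigherBailey.qpow q (HigherBailey.outerExp N ℓ L) * α L) :
    (∀ L : ℕ, Summable fun η : {η : Fin (N - 1) → ℕ // HigherBailey.Congr N L η} =>
        HigherBailey.etaTerm q N ℓ η.1) ∧
    (∀ L : ℕ, (HigherBailey.mnPairs N ℓ L).Finite) ∧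
    (Summable fun L : ℕ => HigherBailey.qpow q (HigherBailey.outerExp N ℓ L) * α L *
        HigherBailey.etaSum q N ℓ L) ∧
    (Summable fun L : ℕ => HigherBailey.qpow q (HigherBailey.outerExp N ℓ L) * β L *
        HigherBailey.fermionicPoly q N ℓ L) ∧
    1 / HigherBailey.qPochInf q (q ^ (ℓ + 1)) *
        ∑' L : ℕ, HigherBailey.qpow q (HigherBailey.outerExp N ℓ L) * α L *
          HigherBailey.etaSum q N ℓ L =
      ∑' L : ℕ, HigherBailey.qpow q (HigherBailey.outerExp N ℓ L) * β L *
        HigherBailey.fermionicPoly q N ℓ L := by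
  have hs := HigherBailey.summable_baileyTerm hq0 hq1 hN hℓ hα
  have hdiag := HigherBailey.sum_antidiagonal_baileyTerm hq0 hq1 hN hℓ hαβ
  refine ⟨fun L => (HigherBailey.summable_etaTerm hq0 hq1 hN hℓ).of_norm.subtype _,
    HigherBailey.finite_mnPairs hN hℓ, ?_, ?_, ?_⟩
  · refine Summable.of_norm_bounded (hα.norm.mul_right
      (∑' η : Fin (N - 1) → ℕ, ‖HigherBailey.etaTerm q N ℓ η‖)) fun L => ?_
    rw [norm_mul]
    gcongr
    exact HigherBailey.norm_etaSum_le hq0 hq1 hN hℓ L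
  · exact (HigherBailey.summable_sum_antidiagonal hs).congr hdiag
  -- Summing the double series by diagonals gives the `β` side, by rows of fixed `k` the `α` side.
  · rw [← tsum_mul_left, ← tsum_congr hdiag, HigherBailey.tsum_sum_antidiagonal hs]
    exact tsum_congr fun k => (HigherBailey.tsum_baileyTerm hq0 hq1 hN hℓ k).symm
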